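/- Let $\mathfrak g$ be a finite-dimensional real semisimple Lie algebra with Killing form $B$, let $\theta$ be a Cartan involution of $\mathfrak g$ and $\mathfrak g=\mathfrak k\oplus\mathfrak p$ the associated Cartan decomposition, and equip $\mathfrak k$, $\mathfrak p$ and their subspaces with the inner product $\langle X,Y\rangle=-B(X,\theta Y)$. Let $\mathfrak a\subset\mathfrak p$ be a maximal abelian subspace, $\Sigma\subset\mathfrak a^*$ the set of restricted roots, $\mathfrak g_\alpha=\{X\in\mathfrak g: [h,X]=\alpha(h)X \text{ for all } h\in\mathfrak a\}$, $m_\alpha=\dim\mathfrak g_\alpha$ for $\alpha\in\mathfrak a^*\setminus\{0\}$ (so $m_{2\alpha}=0$ if $2\alpha\notin\Sigma$), $\Sigma_+$ a choice of positive restricted roots, and $C=\{x\in\mathfrak a:\alpha(x)>0\text{ for all }\alpha\in\Sigma_+\}$ the corresponding open Weyl chamber. Let $K$ be the group acting on $\mathfrak p$ generated by $\exp(\operatorname{ad}X)$, $X\in\mathfrak k$; thus $C=Q/K$, where $Q\subset\mathfrak p$ is the set of regular points of the $K$-action. For $q\in\mathfrak p$ let $\mathfrak k_q=\{X\in\mathfrak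 k:[X,q]=0\}$, let $e_1,\dots,e_k$ be an orthonormal basis of the orthogonal complement of $\mathfrak k_q$ in $\mathfrak k$, and put $$\delta(q)=\bigl|\det\bigl(\langle[e_i,q],[e_j,q]\rangle\bigr)_{i,j}\bigr|^{1/2};$$ denote the restriction of $\delta$ to $C$ by $\delta$ again. Let $\Delta$ and $\nabla$ be the Laplacian and the gradient of the Euclidean space $\mathfrak a$, and let $\Delta^0f=\Delta f+\langle\nabla\log\delta,\nabla f\rangle$ for smooth functions $f$ on $C$. (1) Let $f:C\to\mathbb C$ be a smooth eigenfunction of $\Delta^0$, i.e. $f\not\equiv0$ and $\Delta^0f=\gamma f$ on $C$ for some $\gamma\in\mathbb C$. Then the function $$\psi(t,x)=e^{i\gamma t/2}\sqrt{\delta(x)}\,f(x)$$ is smooth on $\mathbb R\times C$ and solves the rational quantum Calogero–Moser Schrödinger equation $$i\frac{\partial\psi}{\partial t}=\Bigl(-\frac12\Delta+\sum_{\alpha\in\Sigma_+}\frac{m_\alpha(m_\alpha+2m_{2\alpha}-2)\,|\alpha|^2}{8\,\alpha(x)^2}\Bigr)\psi\qquad\text{on }\mathbb R\times C,$$ where $|\alpha|$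 is the norm on $\mathfrak a^*$ dual to that of $\mathfrak a$. (2) Zonal spherical functions provide such eigenfunctions: if $F:\mathfrak p\to\mathbb C$ is smooth and $K$-invariant with $F(0)=1$, and $F$ is an eigenfunction of every $K$-invariant differential operator with constant coefficients on $\mathfrak p$, then $F|_C$ is a smooth eigenfunction of $\Delta^0$, with some eigenvalue $\gamma\in\mathbb C$. -/

import Mathlib

open scoped ContDiff InnerProductSpace
open Set

/-- A Cartan involution `θ` of a real Lie algebra `𝔤` (an involutive automorphism such that
`⟨x, y⟩ = -B(x, θ y)` is positive definite, `B` the Killing form), together with a maximal abelian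
subspace `𝔞` of the `-1`-eigenspace `𝔭` of `θ`. -/
structure CartanData (𝔤 : Type*) [LieRing 𝔤] [LieAlgebra ℝ 𝔤] where
  /-- the Cartan involution -/
  θ : 𝔤 ≃ₗ⁅ℝ⁆ 𝔤
  involutive : ∀ x, θ (θ x) = x
  pos : ∀ x, x ≠ 0 → 0 < -killingForm ℝ 𝔤 x (θ x)
  /-- the maximal abelian subspace of `𝔭` -/
  𝔞 : Submodule ℝ 𝔤
  𝔞_le : ∀ h ∈ 𝔞, θ h = -h
  abelian : ∀ h ∈ 𝔞, ∀ h' ∈ 𝔞, ⁅h, h'⁆ = 0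
  maximal : ∀ 𝔟 : Submodule ℝ 𝔤, (∀ h ∈ 𝔟, θ h = -h) → (∀ h ∈ 𝔟, ∀ h' ∈ 𝔟, ⁅h, h'⁆ = 0) →
    𝔞 ≤ 𝔟 → 𝔟 ≤ 𝔞

namespace CartanData

noncomputable section

variable {𝔤 : Type*} [LieRing 𝔤] [LieAlgebra ℝ 𝔤] (D : CartanData 𝔤)

/-- The `+1`-eigenspace of the Cartan involution. -/
def 𝔨 : Submodule ℝ 𝔤 where
  carrier := {x | D.θ x = x}
  add_mem' {x y} hx hy := by
    have hx' : D.θ x = x := hx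
    have hy' : D.θ y = y := hy
    simp [hx', hy']
  zero_mem' := by simp
  smul_mem' c x hx := by
    have hx' : D.θ x = x := hx
    simp [hx']

/-- The `-1`-eigenspace of the Cartan involution. -/
def 𝔭 : Submodule ℝ 𝔤 where
  carrier := {x | D.θ x = -x}
  add_mem' {x y} hx hy := by
    have hx' : D.θ x = -x := hx
    have hy' : D.θ y = -y := hy
    simp [hx', hy', add_comm]
  zero_mem' := by simp
  smul_mem' c x hx := by
    have hx' : D.θ x = -x := hx
    simp [hx']

theorem killingForm_θ (x y : 𝔤) :
    killingForm ℝ 𝔤 (D.θ x) (D.θ y) = killingForm ℝ 𝔤 x y := by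
  rw [killingForm_apply_apply, killingForm_apply_apply, ← LieAlgebra.conj_ad_apply,
    ← LieAlgebra.conj_ad_apply, ← LinearEquiv.conj_comp, LinearMap.trace_conj']

/-- The inner product `⟨x, y⟩ = -B(x, θ y)`, restricted to a subspace of `𝔤`. -/
@[reducible]
def core (V : Submodule ℝ 𝔤) : InnerProductSpace.Core ℝ V where
  inner x y := -killingForm ℝ 𝔤 (x : 𝔤) (D.θ y)
  conj_inner_symm x y := by
    have h := D.killingForm_θ (y : 𝔤) (D.θ (x : 𝔤))
    rw [D.involutive] at h
    simp [← h, LieModule.traceForm_comm ℝ 𝔤 𝔤 (x : 𝔤)]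
  re_inner_nonneg x := by
    by_cases hx : (x : 𝔤) = 0
    · simp [hx]
    · simpa using! (D.pos x hx).le
  add_left x y z := by simp; ring
  smul_left x y r := by simp
  definite x hx := by
    by_contra h
    have := D.pos x (by simpa using! h)
    exact absurd hx this.ne'

instance : NormedAddCommGroup D.𝔨 := (D.core D.𝔨).toNormedAddCommGroup
instance : InnerProductSpace ℝ D.𝔨 := InnerProductSpace.ofCore (D.core D.𝔨).toCore
instance : NormedAddCommGroup D.𝔭 := (D.core D.𝔭).toNormedAddCommGroup
instance : InnerProductSpace ℝ D.𝔭 := InnerProductSpace.ofCore (D.core D.𝔭).toCore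
instance : NormedAddCommGroup D.𝔞 := (D.core D.𝔞).toNormedAddCommGroup
instance : InnerProductSpace ℝ D.𝔞 := InnerProductSpace.ofCore (D.core D.𝔞).toCore

theorem inner_𝔨 (x y : D.𝔨) : ⟪x, y⟫_ℝ = -killingForm ℝ 𝔤 (x : 𝔤) (D.θ y) := rfl
theorem inner_𝔭 (x y : D.𝔭) : ⟪x, y⟫_ℝ = -killingForm ℝ 𝔤 (x : 𝔤) (D.θ y) := rfl
theorem inner_𝔞 (x y : D.𝔞) : ⟪x, y⟫_ℝ = -killingForm ℝ 𝔤 (x : 𝔤) (D.θ y) := rfl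

theorem bracket_mem (X : D.𝔨) (q : D.𝔭) : ⁅(X : 𝔤), (q : 𝔤)⁆ ∈ D.𝔭 := by
  have hX : D.θ (X : 𝔤) = X := X.2
  have hq : D.θ (q : 𝔤) = -q := q.2
  change D.θ ⁅(X : 𝔤), (q : 𝔤)⁆ = -⁅(X : 𝔤), (q : 𝔤)⁆
  simp [LieEquiv.map_lie, hX, hq]

/-- The fundamental vector field `ζ_X(q) = [X, q]` of the isotropy action, as a linear map on `𝔭`
for fixed `X ∈ 𝔨`. -/
def ζ (X : D.𝔨) : D.𝔭 →ₗ[ℝ] D.𝔭 where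
  toFun q := ⟨⁅(X : 𝔤), (q : 𝔤)⁆, D.bracket_mem X q⟩
  map_add' q q' := by ext; simp
  map_smul' c q := by ext; simp

/-- The infinitesimal stabilizer of `q ∈ 𝔭` in `𝔨`. -/
def stab (q : D.𝔭) : Submodule ℝ D.𝔨 where
  carrier := {X | D.ζ X q = 0}
  add_mem' {X Y} hX hY := by
    have hX' : ⁅(X : 𝔤), (q : 𝔤)⁆ = 0 := congrArg Subtype.val hX
    have hY' : ⁅(Y : 𝔤), (q : 𝔤)⁆ = 0 := congrArg Subtype.val hY
    ext; simp [ζ, hX', hY']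
  zero_mem' := by ext; simp [ζ]
  smul_mem' c X hX := by
    have hX' : ⁅(X : 𝔤), (q : 𝔤)⁆ = 0 := congrArg Subtype.val hX
    ext; simp [ζ, hX']

/-- The inclusion `𝔞 ⊆ 𝔭`. -/
def toP (h : D.𝔞) : D.𝔭 := ⟨h, D.𝔞_le h h.2⟩

/-- The restricted root space `{X | [h, X] = α(h) X for all h ∈ 𝔞}`. -/
def rootSpace (α : StrongDual ℝ D.𝔞) : Submodule ℝ 𝔤 where
  carrier := {X | ∀ h : D.𝔞, ⁅(h : 𝔤), X⁆ = α h • X}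
  add_mem' {X Y} hX hY h := by simp [hX h, hY h]
  zero_mem' h := by simp
  smul_mem' c X hX h := by rw [lie_smul, hX h, smul_comm]

/-- The set `Σ` of restricted roots. -/
def roots : Set (StrongDual ℝ D.𝔞) := {α | α ≠ 0 ∧ D.rootSpace α ≠ ⊥}

/-- The multiplicity `m_α = dim 𝔤_α` (zero when `α` is neither a root nor zero). -/
def mult (α : StrongDual ℝ D.𝔞) : ℕ := Module.finrank ℝ (D.rootSpace α)

/-- `P` is a choice of positive restricted roots: the roots that are positive at some vector of
`𝔞` at which no root vanishes. -/
def IsPositiveSystem (P : Finset (StrongDual ℝ D.𝔞)) : Prop :=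
  ∃ h : D.𝔞, (∀ α ∈ D.roots, α h ≠ 0) ∧ ∀ α, α ∈ P ↔ α ∈ D.roots ∧ 0 < α h

/-- The open Weyl chamber of a positive system. -/
def chamber (P : Finset (StrongDual ℝ D.𝔞)) : Set D.𝔞 := {x | ∀ α ∈ P, 0 < α x}

variable [FiniteDimensional ℝ 𝔤]

instance : CompleteSpace D.𝔞 := FiniteDimensional.complete ℝ D.𝔞

/-- The inertia tensor `𝕀_q(X, Y) = ⟨ζ_X(q), ζ_Y(q)⟩`. -/
def inertia (q : D.𝔭) (X Y : D.𝔨) : ℝ := ⟪D.ζ X q, D.ζ Y q⟫_ℝ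

/-- The orbit volume density `δ(q) = |det 𝕀_q(e_α, e_β)|^{1/2}`, where `e` is an orthonormal basis
of the orthogonal complement in `𝔨` of the stabilizer of `q`. -/
def δ (q : D.𝔭) : ℝ :=
  let e := stdOrthonormalBasis ℝ (D.stab q)ᗮ
  Real.sqrt |(Matrix.of fun i j => D.inertia q (e i) (e j)).det|

/-- The function induced by `δ` on `𝔞`, in particular on the Weyl chamber `C = Q/K`. -/
def δa (x : D.𝔞) : ℝ := D.δ (D.toP x)

/-- The radial operator `Δ⁰ f = Δ f + ⟨∇ log δ, ∇ f⟩`. -/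
def Δ0 (f : D.𝔞 → ℂ) (x : D.𝔞) : ℂ :=
  Laplacian.laplacian f x + fderiv ℝ f x (gradient (fun y => Real.log (D.δa y)) x)

/-- `f` is a (smooth, nonzero) eigenfunction of `Δ⁰` on the Weyl chamber with eigenvalue `γ`. -/
def IsEigenfunction (P : Finset (StrongDual ℝ D.𝔞)) (f : D.𝔞 → ℂ) (γ : ℂ) : Prop :=
  ContDiffOn ℝ ∞ f (D.chamber P) ∧ (∃ x ∈ D.chamber P, f x ≠ 0) ∧
    ∀ x ∈ D.chamber P, D.Δ0 f x = γ * f x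

/-- The rational Calogero–Moser potential
`∑_{α ∈ Σ₊} m_α (m_α + 2 m_{2α} - 2) |α|² / (8 α(x)²)`. -/
def potential (P : Finset (StrongDual ℝ D.𝔞)) (x : D.𝔞) : ℝ :=
  ∑ α ∈ P, (D.mult α : ℝ) * (D.mult α + 2 * D.mult ((2 : ℝ) • α) - 2) * ‖α‖ ^ 2 / (8 * α x ^ 2)

/-- `ψ` is a smooth solution on `ℝ × C` of the rational quantum Calogero–Moser Schrödinger equation
`i ∂ψ/∂t = (-½ Δ + V) ψ`. -/
def SolvesCalogeroMoser (P : Finset (StrongDual ℝ D.𝔞)) (ψ : ℝ → D.𝔞 → ℂ) : Prop :=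
  ContDiffOn ℝ ∞ (fun z : ℝ × D.𝔞 => ψ z.1 z.2) (univ ×ˢ D.chamber P) ∧
    ∀ t : ℝ, ∀ x ∈ D.chamber P,
      Complex.I * deriv (fun s => ψ s x) t =
        -(1 / 2) * Laplacian.laplacian (ψ t) x + (D.potential P x : ℂ) * ψ t x

instance : IsTopologicalRing (D.𝔭 →L[ℝ] D.𝔭) :=
  @NonUnitalSeminormedRing.toIsTopologicalRing (D.𝔭 →L[ℝ] D.𝔭) _

/-- The group `Ad(K)` acting on `𝔭`: it is generated by the maps `exp(ad X)`, `X ∈ 𝔨`. -/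
def K : Subgroup (D.𝔭 ≃L[ℝ] D.𝔭) :=
  Subgroup.closure {g | ∃ X : D.𝔨,
    (g : D.𝔭 →L[ℝ] D.𝔭) = NormedSpace.exp (LinearMap.toContinuousLinearMap (D.ζ X))}

/-- The constant coefficient differential operator `∑ c · ∂_{v₁} ⋯ ∂_{vₙ}` on a real normed space,
given by a formal linear combination of tuples `(v₁, …, vₙ)` of vectors. -/
def _root_.constCoeffOp {E : Type*} [NormedAddCommGroup E] [NormedSpace ℝ E]
    (A : (Σ n : ℕ, Fin n → E) →₀ ℂ) (F : E → ℂ) (q : E) : ℂ :=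
  A.sum fun m c => c * iteratedFDeriv ℝ m.1 F q m.2

/-- `A` commutes with the action of `K` on smooth functions. -/
def IsInvariantOp (A : (Σ n : ℕ, Fin n → D.𝔭) →₀ ℂ) : Prop :=
  ∀ k ∈ D.K, ∀ F : D.𝔭 → ℂ, ContDiff ℝ ∞ F →
    ∀ q, constCoeffOp A (fun y => F (k y)) q = constCoeffOp A F (k q)

/-- Zonal spherical functions of the flat symmetric space `𝔭 = (K ⋉ 𝔭)/K`: smooth `K`-invariant
functions, normalized at the origin, that are eigenfunctions of all differential operators on `𝔭`
invariant under translations and `K`. -/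
def IsZonalSpherical (F : D.𝔭 → ℂ) : Prop :=
  ContDiff ℝ ∞ F ∧ (∀ k ∈ D.K, ∀ q, F (k q) = F q) ∧ F 0 = 1 ∧
    ∀ A, D.IsInvariantOp A → ∃ c : ℂ, ∀ q, constCoeffOp A F q = c * F q

end

end CartanData

/-!
Every `ad h`, `h ∈ 𝔞`, is symmetric for `⟨x, y⟩ = -B(x, θ y)`, so `𝔤` is the orthogonal sum of the
restricted root spaces (`iSup_rootSpace`). Projecting orthonormal bases of the positive root spaces
to `𝔨` and `𝔭` gives orthonormal frames `Z`, `Y` with `[h, Z] = α(h) Y` and `[h, Y] = α(h) Z`; here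
`Z` spans the orthogonal complement of the stabilizer of any point of the Weyl chamber, and `Y`
completes `𝔞` to `𝔭`. Hence `δ = ∏ α ^ m_α` on the chamber (`δa_eq_prod`).

For the Schrödinger equation one computes `Δ (√δ f) = √δ (Δ⁰ f) + (Δ √δ) f`, so it has to be shown
that `Δ √δ = 2 V √δ`. With `log δ = ∑ m_α log α` this reduces to a formula for
`∑ m_α m_β ⟨α, β⟩ / (α β)` over pairs of positive roots (`sum_sum_mult_mul_mult`). Pairs of
proportional roots have ratio `1/2`, `1` or `2`, by the representation theory of `sl₂`, and give the
potential. The other pairs cancel: by partial fractions it suffices that the residue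
`∑ m_β ⟨α, β⟩ / β(x)` vanishes for `x ∈ ker α` (`sum_mult_apply_rootVec_mul_inv`). This residue is
half the trace of `ad A_α ∘ p(ad x)`, where `A_α` is the vector dual to `α` and the polynomial `p`
sends the eigenvalues `t` of `ad x` to `t⁻¹`, with `0⁻¹ = 0`. As `A_α` is a multiple of `[X, θX]` for
`X` in the root space of `α`, and `ad X` commutes with `ad x`, the trace is that of a commutator.

For the second part, the Laplacian of `𝔭` has constant coefficients and commutes with `K`, which acts
by isometries, so `F` is an eigenfunction of it. Differentiating the infinitesimal invariance
`DF(q)[X, q] = 0` once more, with `X = Z_i`, expresses the second derivatives of `F` in the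
directions `Y_i` through first derivatives along `𝔞`. The sum is the first order term of `Δ⁰`, so the
radial part of the Laplacian is `Δ⁰` (`laplacian_toP`). Finally `F` does not vanish identically on
the chamber because `F(0) = 1` and the origin is in its closure.
-/

/-! ### Restricted root spaces -/

namespace CartanData

noncomputable section

variable {𝔤 : Type*} [LieRing 𝔤] [LieAlgebra ℝ 𝔤] (D : CartanData 𝔤)

theorem killingForm_lie_left (x y z : 𝔤) :
    killingForm ℝ 𝔤 ⁅x, y⁆ z = killingForm ℝ 𝔤 x ⁅y, z⁆ :=
  LieModule.traceForm_apply_lie_apply ℝ 𝔤 𝔤 x y z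

theorem θ_coe_𝔨 (x : D.𝔨) : D.θ (x : 𝔤) = x := x.2

theorem θ_coe_𝔭 (x : D.𝔭) : D.θ (x : 𝔤) = -x := x.2

theorem θ_coe_𝔞 (x : D.𝔞) : D.θ (x : 𝔤) = -x := D.𝔞_le x x.2

theorem killingForm_θ_left (x y : 𝔤) :
    killingForm ℝ 𝔤 (D.θ x) y = killingForm ℝ 𝔤 x (D.θ y) := by
  rw [← D.killingForm_θ x, D.involutive]

theorem mem_rootSpace {α : StrongDual ℝ D.𝔞} {X : 𝔤} :
    X ∈ D.rootSpace α ↔ ∀ h : D.𝔞, ⁅(h : 𝔤), X⁆ = α h • X := Iff.rfl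

theorem θ_mem_rootSpace {α : StrongDual ℝ D.𝔞} {X : 𝔤} (hX : X ∈ D.rootSpace α) :
    D.θ X ∈ D.rootSpace (-α) := fun h => by
  have : (h : 𝔤) = D.θ (-h) := by rw [map_neg, D.θ_coe_𝔞, neg_neg]
  rw [this, ← LieEquiv.map_lie, neg_lie, hX h]
  simp

theorem lie_mem_rootSpace {α β : StrongDual ℝ D.𝔞} {X Y : 𝔤} (hX : X ∈ D.rootSpace α)
    (hY : Y ∈ D.rootSpace β) : ⁅X, Y⁆ ∈ D.rootSpace (α + β) := fun h => by
  rw [leibniz_lie, hX h, hY h]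
  simp [add_smul]

/-- The involution `θ` exchanges the root spaces of `α` and `-α`. -/
theorem mult_neg (α : StrongDual ℝ D.𝔞) : D.mult (-α) = D.mult α := by
  have h : (D.rootSpace α).map (D.θ.toLinearEquiv : 𝔤 →ₗ[ℝ] 𝔤) = D.rootSpace (-α) := by
    ext X
    constructor
    · rintro ⟨Y, hY, rfl⟩
      exact D.θ_mem_rootSpace hY
    · intro hX
      exact ⟨D.θ X, by simpa using D.θ_mem_rootSpace hX, D.involutive X⟩
  rw [mult, mult, ← h]
  exact LinearEquiv.finrank_map_eq D.θ.toLinearEquiv _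

theorem neg_mem_roots {α : StrongDual ℝ D.𝔞} (h : α ∈ D.roots) : -α ∈ D.roots := by
  refine ⟨neg_ne_zero.2 h.1, ?_⟩
  obtain ⟨X, hX, h0⟩ := (Submodule.ne_bot_iff _).1 h.2
  exact (Submodule.ne_bot_iff _).2 ⟨D.θ X, D.θ_mem_rootSpace hX, by simpa using h0⟩

/-- By maximality, `𝔞` is its own centralizer in `𝔭`. -/
theorem mem_𝔞_of_lie_eq_zero {x : 𝔤} (hx : D.θ x = -x) (h : ∀ y : D.𝔞, ⁅(y : 𝔤), x⁆ = 0) :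
    x ∈ D.𝔞 := by
  refine D.maximal (D.𝔞 ⊔ Submodule.span ℝ {x}) ?_ ?_ le_sup_left
    (le_sup_right (a := D.𝔞) (Submodule.mem_span_singleton_self x))
  · intro z hz
    obtain ⟨y, hy, w, hw, rfl⟩ := Submodule.mem_sup.1 hz
    obtain ⟨c, rfl⟩ := Submodule.mem_span_singleton.1 hw
    simp [D.𝔞_le y hy, hx, add_comm]
  · intro z hz z' hz'
    obtain ⟨y, hy, w, hw, rfl⟩ := Submodule.mem_sup.1 hz
    obtain ⟨c, rfl⟩ := Submodule.mem_span_singleton.1 hw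
    obtain ⟨y', hy', w', hw', rfl⟩ := Submodule.mem_sup.1 hz'
    obtain ⟨c', rfl⟩ := Submodule.mem_span_singleton.1 hw'
    have h1 := h ⟨y, hy⟩
    have h2 := h ⟨y', hy'⟩
    rw [← lie_skew, neg_eq_zero] at h2
    simp only at h1 h2
    simp [D.abelian y hy y' hy', h1, h2]

/-- The positive definite form `-B(x, θ y)` on all of `𝔤`. -/
@[reducible]
def totalCore : InnerProductSpace.Core ℝ 𝔤 where
  inner x y := -killingForm ℝ 𝔤 x (D.θ y)
  conj_inner_symm x y := by
    have h := D.killingForm_θ y (D.θ x)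
    rw [D.involutive] at h
    simp [← h, LieModule.traceForm_comm ℝ 𝔤 𝔤 x]
  re_inner_nonneg x := by
    by_cases hx : x = 0
    · simp [hx]
    · simpa using! (D.pos x hx).le
  add_left x y z := by simp; ring
  smul_left x y r := by simp
  definite x hx := by
    by_contra h
    exact absurd hx (D.pos x h).ne'

theorem killingForm_lie_θ (h : D.𝔞) (x y : 𝔤) :
    killingForm ℝ 𝔤 ⁅(h : 𝔤), x⁆ (D.θ y) = killingForm ℝ 𝔤 x (D.θ ⁅(h : 𝔤), y⁆) := by
  rw [← lie_skew, map_neg, LinearMap.neg_apply, killingForm_lie_left, LieEquiv.map_lie,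
    D.θ_coe_𝔞, neg_lie, map_neg]

/-- Root spaces of different functionals are orthogonal. -/
theorem killingForm_θ_eq_zero {α β : StrongDual ℝ D.𝔞} (hne : α ≠ β) {X Y : 𝔤}
    (hX : X ∈ D.rootSpace α) (hY : Y ∈ D.rootSpace β) : killingForm ℝ 𝔤 X (D.θ Y) = 0 := by
  obtain ⟨h, hh⟩ : ∃ h, α h ≠ β h := by
    by_contra! hcon
    exact hne (ContinuousLinearMap.ext hcon)
  have h1 := D.killingForm_lie_θ h X Y
  rw [hX h, hY h] at h1
  simp only [map_smul, LinearMap.smul_apply, smul_eq_mul] at h1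
  have : (α h - β h) * killingForm ℝ 𝔤 X (D.θ Y) = 0 := by linarith
  exact (mul_eq_zero.1 this).resolve_left (sub_ne_zero.2 hh)

variable [FiniteDimensional ℝ 𝔤]

/-- The operators `ad h`, `h ∈ 𝔞`, are symmetric and commute, so they are simultaneously
diagonalizable. -/
theorem iSup_rootSpace : ⨆ α, D.rootSpace α = ⊤ := by
  let T : D.𝔞 → 𝔤 →ₗ[ℝ] 𝔤 := fun h => (LieAlgebra.ad ℝ 𝔤 (h : 𝔤) : 𝔤 →ₗ[ℝ] 𝔤)
  have hc : Pairwise (Function.onFun Commute T) := by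
    intro h h' _
    refine LinearMap.ext fun x => ?_
    change ⁅(h : 𝔤), ⁅(h' : 𝔤), x⁆⁆ = ⁅(h' : 𝔤), ⁅(h : 𝔤), x⁆⁆
    rw [leibniz_lie, D.abelian h h.2 h' h'.2, zero_lie, zero_add]
  have key : ⨆ χ : D.𝔞 → ℝ, ⨅ h, Module.End.eigenspace (T h) (χ h) = ⊤ := by
    let : NormedAddCommGroup 𝔤 := D.totalCore.toNormedAddCommGroup
    let : InnerProductSpace ℝ 𝔤 := InnerProductSpace.ofCore D.totalCore.toCore
    have hT : ∀ h, (T h).IsSymmetric := fun h x y =>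
      congrArg Neg.neg (D.killingForm_lie_θ h x y)
    exact LinearMap.IsSymmetric.iSup_iInf_eq_top_of_commute hT hc
  rw [eq_top_iff, ← key]
  refine iSup_le fun χ => ?_
  intro X hX
  have hX' : ∀ h : D.𝔞, ⁅(h : 𝔤), X⁆ = χ h • X := by
    intro h
    have := (Submodule.mem_iInf _).1 hX h
    exact Module.End.mem_eigenspace_iff.1 this
  by_cases h0 : X = 0
  · simp [h0]
  -- a nonzero joint eigenvector forces the joint eigenvalue to be linear
  let l : D.𝔞 →ₗ[ℝ] ℝ :=
    { toFun := χ
      map_add' := fun a b => by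
        have h1 := hX' (a + b)
        rw [Submodule.coe_add, add_lie, hX', hX', ← add_smul] at h1
        exact (smul_left_injective ℝ h0 h1).symm
      map_smul' := fun c a => by
        have h1 := hX' (c • a)
        rw [Submodule.coe_smul, smul_lie, hX', smul_smul] at h1
        exact (smul_left_injective ℝ h0 h1).symm }
  exact Submodule.mem_iSup_of_mem (LinearMap.toContinuousLinearMap l) (fun h => hX' h)

theorem isInternal_rootSpace [DecidableEq (StrongDual ℝ D.𝔞)] :
    DirectSum.IsInternal D.rootSpace := by
  let : NormedAddCommGroup 𝔤 := D.totalCore.toNormedAddCommGroup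
  let : InnerProductSpace ℝ 𝔤 := InnerProductSpace.ofCore D.totalCore.toCore
  have hO : OrthogonalFamily ℝ (fun α => D.rootSpace α) fun α => (D.rootSpace α).subtypeₗᵢ := by
    intro α β hne X Y
    have := D.killingForm_θ_eq_zero hne X.2 Y.2
    exact neg_eq_zero.2 this
  rw [DirectSum.isInternal_submodule_iff_iSupIndep_and_iSup_eq_top]
  exact ⟨hO.independent, D.iSup_rootSpace⟩

theorem finite_rootSpace_ne_bot : {α | D.rootSpace α ≠ ⊥}.Finite := by
  classical
  exact WellFoundedGT.finite_ne_bot_of_iSupIndep D.isInternal_rootSpace.submodule_iSupIndep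

theorem trace_eq_sum_mult (f : 𝔤 →ₗ[ℝ] 𝔤) (c : StrongDual ℝ D.𝔞 → ℝ)
    (hf : ∀ α, ∀ X ∈ D.rootSpace α, f X = c α • X) :
    LinearMap.trace ℝ 𝔤 f = ∑ α ∈ D.finite_rootSpace_ne_bot.toFinset, D.mult α * c α := by
  classical
  have hm : ∀ α, MapsTo f (D.rootSpace α) (D.rootSpace α) := fun α X hX => by
    rw [SetLike.mem_coe, hf α X hX]
    exact Submodule.smul_mem _ _ hX
  rw [LinearMap.trace_eq_sum_trace_restrict' D.isInternal_rootSpace D.finite_rootSpace_ne_bot hm]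
  refine Finset.sum_congr rfl fun α _ => ?_
  have : f.restrict (hm α) = c α • LinearMap.id := by
    ext X
    simpa using! hf α X X.2
  rw [this, map_smul, LinearMap.trace_id, mult, smul_eq_mul, mul_comm]

end

end CartanData

/-! ### Identities between multiplicities -/

namespace CartanData

noncomputable section

variable {𝔤 : Type*} [LieRing 𝔤] [LieAlgebra ℝ 𝔤] (D : CartanData 𝔤)

theorem IsPositiveSystem.mem_roots {D : CartanData 𝔤} {P : Finset (StrongDual ℝ D.𝔞)}
    (hP : D.IsPositiveSystem P) {α : StrongDual ℝ D.𝔞} (hα : α ∈ P) : α ∈ D.roots := by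
  obtain ⟨h, -, h2⟩ := hP
  exact ((h2 α).1 hα).1

theorem aeval_ad_apply {α : StrongDual ℝ D.𝔞} (x : D.𝔞) (p : Polynomial ℝ) {v : 𝔤}
    (hv : v ∈ D.rootSpace α) :
    Polynomial.aeval (LieAlgebra.ad ℝ 𝔤 (x : 𝔤) : Module.End ℝ 𝔤) p v = p.eval (α x) • v := by
  by_cases h0 : v = 0
  · simp [h0]
  · exact Module.End.aeval_apply_of_hasEigenvector
      ⟨Module.End.mem_eigenspace_iff.2 (hv x), h0⟩

variable [FiniteDimensional ℝ 𝔤]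

/-- The vector `A_α ∈ 𝔞` representing the functional `α` through the inner product. -/
def rootVec (α : StrongDual ℝ D.𝔞) : D.𝔞 := (InnerProductSpace.toDual ℝ D.𝔞).symm α

theorem inner_rootVec (α : StrongDual ℝ D.𝔞) (h : D.𝔞) : ⟪D.rootVec α, h⟫_ℝ = α h :=
  InnerProductSpace.toDual_symm_apply

theorem apply_rootVec_comm (α β : StrongDual ℝ D.𝔞) : α (D.rootVec β) = β (D.rootVec α) := by
  rw [← D.inner_rootVec, ← D.inner_rootVec, real_inner_comm]

theorem apply_rootVec_self (α : StrongDual ℝ D.𝔞) : α (D.rootVec α) = ‖α‖ ^ 2 := by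
  rw [← D.inner_rootVec, real_inner_self_eq_norm_sq, rootVec, LinearIsometryEquiv.norm_map]

theorem apply_rootVec_self_pos {α : StrongDual ℝ D.𝔞} (hα : α ≠ 0) : 0 < α (D.rootVec α) := by
  rw [← D.inner_rootVec, real_inner_self_pos]
  exact (LinearIsometryEquiv.map_eq_zero_iff _).not.2 hα

theorem rootVec_smul (c : ℝ) (α : StrongDual ℝ D.𝔞) : D.rootVec (c • α) = c • D.rootVec α := by
  simp [rootVec]

/-- For a root vector `X` the bracket `[X, θX]` lies in `𝔭` and centralizes `𝔞`, so it lies in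
`𝔞`; invariance of the Killing form identifies it. -/
theorem lie_θ_self {α : StrongDual ℝ D.𝔞} {X : 𝔤} (hX : X ∈ D.rootSpace α) :
    ⁅X, D.θ X⁆ = killingForm ℝ 𝔤 X (D.θ X) • (D.rootVec α : 𝔤) := by
  have hW : ⁅X, D.θ X⁆ ∈ D.𝔞 := by
    refine D.mem_𝔞_of_lie_eq_zero ?_ fun h => ?_
    · rw [LieEquiv.map_lie, D.involutive, ← lie_skew]
    · rw [D.lie_mem_rootSpace hX (D.θ_mem_rootSpace hX) h]
      simp
  suffices h : (⟨⁅X, D.θ X⁆, hW⟩ : D.𝔞) = killingForm ℝ 𝔤 X (D.θ X) • D.rootVec α from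
    congrArg Subtype.val h
  refine ext_inner_right ℝ fun h => ?_
  rw [real_inner_smul_left, D.inner_rootVec, D.inner_𝔞, D.θ_coe_𝔞, map_neg, neg_neg,
    killingForm_lie_left, ← lie_skew, D.θ_mem_rootSpace hX h]
  simp [mul_comm]

/-- For a root `α` and `x ∈ ker α` the operator `ad A_α ∘ p(ad x)` is traceless: `A_α` is a multiple
of a commutator `[X, θX]`, and `ad X` commutes with `p(ad x)`. -/
theorem sum_mult_apply_rootVec_mul_eval {α : StrongDual ℝ D.𝔞} (hα : α ∈ D.roots) {x : D.𝔞}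
    (hx : α x = 0) (p : Polynomial ℝ) :
    ∑ β ∈ D.finite_rootSpace_ne_bot.toFinset,
      D.mult β * (β (D.rootVec α) * p.eval (β x)) = 0 := by
  obtain ⟨X, hX, h0⟩ := (Submodule.ne_bot_iff _).1 hα.2
  have hN : killingForm ℝ 𝔤 X (D.θ X) ≠ 0 := by
    exact (neg_pos.1 (D.pos X h0)).ne
  let a : Module.End ℝ 𝔤 := LieAlgebra.ad ℝ 𝔤 X
  let b : Module.End ℝ 𝔤 := LieAlgebra.ad ℝ 𝔤 (D.θ X)
  let G : Module.End ℝ 𝔤 := Polynomial.aeval (LieAlgebra.ad ℝ 𝔤 (x : 𝔤) : Module.End ℝ 𝔤) p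
  let A : Module.End ℝ 𝔤 := LieAlgebra.ad ℝ 𝔤 (D.rootVec α : 𝔤)
  have h1 : Commute a (LieAlgebra.ad ℝ 𝔤 (x : 𝔤)) := by
    refine LinearMap.ext fun y => ?_
    change ⁅X, ⁅(x : 𝔤), y⁆⁆ = ⁅(x : 𝔤), ⁅X, y⁆⁆
    rw [leibniz_lie (x : 𝔤), hX x, hx, zero_smul, zero_lie, zero_add]
  have hcomm : a * G = G * a := by
    change Commute a G
    simp only [G, Polynomial.aeval_eq_sum_range]
    exact Commute.sum_right _ _ _ fun i _ => (h1.pow_right i).smul_right _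
  have hA : killingForm ℝ 𝔤 X (D.θ X) • A = a * b - b * a := by
    refine LinearMap.ext fun y => ?_
    change killingForm ℝ 𝔤 X (D.θ X) • ⁅(D.rootVec α : 𝔤), y⁆ =
      ⁅X, ⁅D.θ X, y⁆⁆ - ⁅D.θ X, ⁅X, y⁆⁆
    rw [← smul_lie, ← D.lie_θ_self hX, lie_lie]
  have htr : LinearMap.trace ℝ 𝔤 (A * G) = 0 := by
    have h1 : killingForm ℝ 𝔤 X (D.θ X) * LinearMap.trace ℝ 𝔤 (A * G) = 0 := by
      rw [← smul_eq_mul, ← map_smul, ← smul_mul_assoc, hA, sub_mul, map_sub, mul_assoc,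
        LinearMap.trace_mul_comm, mul_assoc, ← hcomm, mul_assoc, sub_self]
    exact (mul_eq_zero.1 h1).resolve_left hN
  rw [← htr, D.trace_eq_sum_mult (A * G) fun β => β (D.rootVec α) * p.eval (β x)]
  intro β v hv
  rw [Module.End.mul_apply, D.aeval_ad_apply x p hv, map_smul]
  change _ • ⁅(D.rootVec α : 𝔤), v⁆ = _
  rw [hv, smul_smul, mul_comm]

/-- Integrality of `2c = 2⟨cα, α⟩ / |α|²`, from the `sl₂`-triple spanned by `X`, `θX` and
`A_α`. -/
theorem exists_int_of_smul_mem_roots {α : StrongDual ℝ D.𝔞} (hα : α ∈ D.roots) {c : ℝ}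
    (hc : c • α ∈ D.roots) : ∃ n : ℤ, 2 * c = n := by
  obtain ⟨X, hX, h0⟩ := (Submodule.ne_bot_iff _).1 hα.2
  obtain ⟨v, hv, hv0⟩ := (Submodule.ne_bot_iff _).1 hc.2
  have hN : killingForm ℝ 𝔤 X (D.θ X) ≠ 0 := by
    exact (neg_pos.1 (D.pos X h0)).ne
  have hs := (D.apply_rootVec_self_pos hα.1).ne'
  set N := killingForm ℝ 𝔤 X (D.θ X) with hNdef
  set s := α (D.rootVec α) with hsdef
  let H : D.𝔞 := (2 / s) • D.rootVec α
  have hαH : α H = 2 := by simp [H, ← hsdef, hs]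
  have hH : (H : 𝔤) = (2 / s) • (D.rootVec α : 𝔤) := rfl
  -- the coefficient of `θX` is dictated by `[X, θX] = N A_α`
  have t : IsSl2Triple (H : 𝔤) X ((2 / (s * N)) • D.θ X) :=
    { h_ne_zero := fun h => by
        have : H = 0 := Subtype.ext h
        simp [this] at hαH
      lie_e_f := by
        rw [lie_smul, D.lie_θ_self hX, smul_smul, hH, ← hNdef]
        congr 1
        field_simp
      lie_h_e_nsmul := by rw [hX H, hαH, ← Nat.cast_smul_eq_nsmul ℝ]; norm_num
      lie_h_f_nsmul := by
        rw [lie_smul, D.θ_mem_rootSpace hX H, neg_apply, hαH,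
          ← Nat.cast_smul_eq_nsmul ℝ, smul_comm, neg_smul]
        norm_num }
  let w : ℕ → 𝔤 := fun n => (LieModule.toEnd ℝ 𝔤 𝔤 X ^ n) v
  have hw : ∀ n : ℕ, w n ∈ D.rootSpace ((c + n) • α) := by
    intro n
    induction n with
    | zero => simpa [w] using hv
    | succ n ih =>
      have h1 := D.lie_mem_rootSpace hX ih
      have h2 : w (n + 1) = ⁅X, w n⁆ := by simp [w, pow_succ']
      have h3 : (c + ((n + 1 : ℕ) : ℝ)) • α = α + (c + n) • α := by
        rw [Nat.cast_succ, add_comm α, ← add_assoc, add_smul _ (1 : ℝ), one_smul]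
      rw [h2, h3]
      exact h1
  -- the `α`-string through `c α` is finite, so it ends in a primitive vector
  have hex : ∃ n, w n = 0 := by
    by_contra! hcon
    have hinj : Function.Injective fun n : ℕ => (c + n) • α := by
      intro m n hmn
      have := smul_left_injective ℝ hα.1 hmn
      exact_mod_cast add_left_cancel this
    refine Set.infinite_of_injective_forall_mem hinj (fun n => ?_) D.finite_rootSpace_ne_bot
    exact (Submodule.ne_bot_iff _).2 ⟨w n, hw n, hcon n⟩
  obtain ⟨n, hn, hn'⟩ := Nat.exists_not_and_succ_of_not_zero_of_exists
    (p := fun n => w n = 0) (by simpa [w] using hv0) hex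
  have hp : t.HasPrimitiveVectorWith (w n) ((c + n) * 2) :=
    { ne_zero := hn
      lie_h := by rw [hw n H, smul_apply, hαH, smul_eq_mul]
      lie_e := by rw [← hn']; simp [w, pow_succ'] }
  obtain ⟨m, hm⟩ := hp.exists_nat
  refine ⟨m - 2 * n, ?_⟩
  push_cast
  linarith

/-- Two positively proportional restricted roots have ratio `1/2`, `1` or `2`. -/
theorem eq_of_smul_mem_roots {α : StrongDual ℝ D.𝔞} (hα : α ∈ D.roots) {c : ℝ} (hc0 : 0 < c)
    (hc : c • α ∈ D.roots) : c = 1 / 2 ∨ c = 1 ∨ c = 2 := by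
  obtain ⟨m, hm⟩ := D.exists_int_of_smul_mem_roots hα hc
  obtain ⟨k, hk⟩ := D.exists_int_of_smul_mem_roots (c := c⁻¹) hc
    (by rwa [smul_smul, inv_mul_cancel₀ hc0.ne', one_smul])
  have hmk : m * k = 4 := by
    have : (m : ℝ) * k = 4 := by rw [← hm, ← hk]; field_simp; norm_num
    exact_mod_cast this
  have hm0 : 0 < m := by
    have : (0 : ℝ) < m := by rw [← hm]; positivity
    exact_mod_cast this
  have hk0 : 0 < k := by
    have : (0 : ℝ) < k := by rw [← hk]; positivity
    exact_mod_cast this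
  have hm4 : m ≤ 4 := by nlinarith
  interval_cases m
  · left; push_cast at hm; linarith
  · right; left; push_cast at hm; linarith
  · omega
  · right; right; push_cast at hm; linarith

variable {P : Finset (StrongDual ℝ D.𝔞)}

/-- The weights of `𝔞` on `𝔤` are the roots and possibly `0`, and the roots are the positive ones
and their negatives. -/
theorem sum_eq_two_mul_sum_pos (hP : D.IsPositiveSystem P) (g : StrongDual ℝ D.𝔞 → ℝ)
    (g0 : g 0 = 0) (geven : ∀ α, g (-α) = g α) :
    ∑ α ∈ D.finite_rootSpace_ne_bot.toFinset, g α = 2 * ∑ α ∈ P, g α := by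
  classical
  obtain ⟨h, h1, h2⟩ := hP
  have hpos : (D.finite_rootSpace_ne_bot.toFinset.filter fun α => 0 < α h) = P := by
    ext α
    rw [Finset.mem_filter, h2, Set.Finite.mem_toFinset]
    refine and_congr_left fun hα => ⟨fun hb => ⟨?_, hb⟩, fun hb => hb.2⟩
    rintro rfl
    simp at hα
  have hneg : ∑ α ∈ D.finite_rootSpace_ne_bot.toFinset.filter (fun α => ¬ 0 < α h), g α =
      ∑ α ∈ P, g α := by
    rw [← Finset.sum_erase _ g0]
    refine Finset.sum_nbij' (fun α => -α) (fun α => -α) ?_ ?_ (by simp) (by simp)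
      (fun α _ => (geven α).symm)
    · intro α hα
      rw [Finset.mem_erase, Finset.mem_filter, Set.Finite.mem_toFinset] at hα
      have hr : α ∈ D.roots := ⟨hα.1, hα.2.1⟩
      rw [h2]
      refine ⟨D.neg_mem_roots hr, ?_⟩
      have := lt_of_le_of_ne (not_lt.1 hα.2.2) (h1 α hr)
      simpa using this
    · intro α hα
      obtain ⟨hr, hα⟩ := (h2 α).1 hα
      have hr' := D.neg_mem_roots hr
      rw [Finset.mem_erase, Finset.mem_filter, Set.Finite.mem_toFinset]
      exact ⟨hr'.1, hr'.2, by simpa using hα.le⟩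
  rw [← Finset.sum_filter_add_sum_filter_not _ (fun α => 0 < α h), hneg, hpos, two_mul]

/-- The residue along `ker α` of `∑ m_β ⟨α, β⟩ / (α β)` vanishes; the convention `0⁻¹ = 0`
discards the roots `β` that vanish at `x`. -/
theorem sum_mult_apply_rootVec_mul_inv (hP : D.IsPositiveSystem P) {α : StrongDual ℝ D.𝔞}
    (hα : α ∈ D.roots) {x : D.𝔞} (hx : α x = 0) :
    ∑ β ∈ P, D.mult β * (β (D.rootVec α) * (β x)⁻¹) = 0 := by
  classical
  -- apply the trace identity to a polynomial that agrees with `t ↦ t⁻¹` on the spectrum of `ad x`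
  let S := D.finite_rootSpace_ne_bot.toFinset
  let T : Finset ℝ := S.image fun β => β x
  have h1 := D.sum_mult_apply_rootVec_mul_eval hα hx (Lagrange.interpolate T id fun t => t⁻¹)
  have h2 : ∑ β ∈ S, D.mult β * (β (D.rootVec α) * (β x)⁻¹) = 0 := by
    rw [← h1]
    refine Finset.sum_congr rfl fun β hβ => ?_
    congr 2
    exact (Lagrange.eval_interpolate_at_node _ (injOn_id _)
      (Finset.mem_image_of_mem (fun β => β x) hβ)).symm
  rw [D.sum_eq_two_mul_sum_pos hP] at h2
  · simpa using h2
  · simp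
  · intro β
    simp [D.mult_neg]

end

end CartanData

namespace CartanData

noncomputable section

variable {𝔤 : Type*} [LieRing 𝔤] [LieAlgebra ℝ 𝔤] (D : CartanData 𝔤)
variable {P : Finset (StrongDual ℝ D.𝔞)}

theorem mult_eq_zero {α : StrongDual ℝ D.𝔞} (h0 : α ≠ 0) (h : α ∉ D.roots) : D.mult α = 0 := by
  have : D.rootSpace α = ⊥ := by
    by_contra hne
    exact h ⟨h0, hne⟩
  rw [mult, this, finrank_bot]

/-- A vector `v` in general position with respect to `x`: positive roots whose restrictions to the
span of `v` and `x` are proportional are themselves proportional. -/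
theorem exists_forall_proportional {x : D.𝔞} (hx : x ∈ D.chamber P) :
    ∃ v : D.𝔞, ∀ α ∈ P, ∀ β ∈ P, α v * β x - α x * β v = 0 → β = (β x / α x) • α := by
  let f : P × P → Module.Dual ℝ D.𝔞 := fun p =>
    ((p.2.1 x • p.1.1 - p.1.1 x • p.2.1 : StrongDual ℝ D.𝔞) : D.𝔞 →ₗ[ℝ] ℝ)
  obtain ⟨v, -, hv⟩ := Module.Dual.exists_forall_mem_ne_zero_of_forall_exists ⊤
    (fun p : {p // f p ≠ 0} => f p.1) (fun p => by
      by_contra! hcon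
      exact p.2 (LinearMap.ext fun y => hcon y trivial))
  refine ⟨v, fun α hα β hβ h => ?_⟩
  have hf : f (⟨α, hα⟩, ⟨β, hβ⟩) = 0 := by
    by_contra hne
    refine hv ⟨_, hne⟩ ?_
    change β x * α v - α x * β v = 0
    linarith
  refine ContinuousLinearMap.ext fun y => ?_
  have hy : β x * α y - α x * β y = 0 := LinearMap.congr_fun hf y
  have := (hx α hα).ne'
  simp only [smul_apply, smul_eq_mul]
  field_simp
  linarith

variable [FiniteDimensional ℝ 𝔤]

/-- Only proportional pairs of roots contribute to `∑ m_α m_β ⟨α, β⟩ / (α(x) β(x))`. In partial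
fractions along a line through `x` in a generic direction `v`, the residues of the other terms
vanish. -/
theorem sum_sum_eq_sum_proportional (hP : D.IsPositiveSystem P) {x v : D.𝔞}
    (hx : x ∈ D.chamber P) :
    ∑ α ∈ P, ∑ β ∈ P, D.mult α * D.mult β * α (D.rootVec β) / (α x * β x) =
      ∑ α ∈ P, ∑ β ∈ P, if α v * β x - α x * β v = 0 then
        D.mult α * D.mult β * α (D.rootVec β) / (α x * β x) else 0 := by
  have key : ∀ α ∈ P, ∑ β ∈ P, (D.mult α : ℝ) * D.mult β * α (D.rootVec β) *
      (α v / α x * (α v * β x - α x * β v)⁻¹) = 0 := by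
    intro α hα
    -- the residue is taken at the point where the line meets `ker α`, rescaled by `α v`
    have h := D.sum_mult_apply_rootVec_mul_inv hP (hP.mem_roots hα) (x := α v • x - α x • v)
      (by simp [mul_comm])
    calc _ = ∑ β ∈ P, (D.mult α * (α v / α x)) *
          (D.mult β * (β (D.rootVec α) * (β (α v • x - α x • v))⁻¹)) := by
          refine Finset.sum_congr rfl fun β _ => ?_
          rw [D.apply_rootVec_comm α β, map_sub, map_smul, map_smul, smul_eq_mul, smul_eq_mul]
          ring
      _ = 0 := by rw [← Finset.mul_sum, h, mul_zero]
  have key' : ∑ α ∈ P, ∑ β ∈ P, (D.mult α : ℝ) * D.mult β * α (D.rootVec β) *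
      (β v / β x * (β v * α x - β x * α v)⁻¹) = 0 := by
    rw [Finset.sum_comm]
    refine Finset.sum_eq_zero fun α hα => ?_
    rw [← key α hα]
    refine Finset.sum_congr rfl fun β _ => ?_
    rw [D.apply_rootVec_comm α β]
    ring
  -- with `d = α v * β x - α x * β v` the partial fraction identity for `d ≠ 0` is
  -- `1 / (α x * β x) = α v / (α x * d) - β v / (β x * d)`
  have key'' := congrArg₂ (· + ·) (Finset.sum_eq_zero key) key'
  simp only [← Finset.sum_add_distrib, add_zero] at key''
  refine sub_eq_zero.1 (Eq.trans ?_ key'')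
  rw [← Finset.sum_sub_distrib]
  refine Finset.sum_congr rfl fun α hα => ?_
  rw [← Finset.sum_sub_distrib]
  refine Finset.sum_congr rfl fun β hβ => ?_
  have h1 := (hx α hα).ne'
  have h2 := (hx β hβ).ne'
  have h3 : β v * α x - β x * α v = -(α v * β x - α x * β v) := by ring
  rw [h3]
  split_ifs with h
  · simp [h]
  · rw [← mul_add, sub_zero, div_eq_mul_inv]
    congr 1
    generalize hd : α v * β x - α x * β v = d at h
    field_simp
    linarith

/-- The double sum in `¼ |∇ log δ|²`. -/
theorem sum_sum_mult_mul_mult (hP : D.IsPositiveSystem P) {x : D.𝔞} (hx : x ∈ D.chamber P) :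
    ∑ α ∈ P, ∑ β ∈ P, D.mult α * D.mult β * α (D.rootVec β) / (α x * β x) =
      ∑ α ∈ P, D.mult α * (D.mult α + 2 * D.mult ((2 : ℝ) • α)) * ‖α‖ ^ 2 / α x ^ 2 := by
  classical
  obtain ⟨v, hv⟩ := D.exists_forall_proportional hx
  rw [D.sum_sum_eq_sum_proportional hP (v := v) hx]
  let T : StrongDual ℝ D.𝔞 → StrongDual ℝ D.𝔞 → ℝ := fun α β =>
    D.mult α * D.mult β * α (D.rootVec β) / (α x * β x)
  have hT : ∀ α β, T α β = T β α := fun α β => by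
    simp only [T]
    rw [D.apply_rootVec_comm α β]
    ring
  -- a root proportional to `α` is `α`, `2α` or `α / 2`
  have hsplit : ∀ α ∈ P, ∀ β ∈ P,
      (if α v * β x - α x * β v = 0 then T α β else 0) =
        (if α = β then T α β else 0) + (if (2 : ℝ) • α = β then T α β else 0) +
          (if (2 : ℝ) • β = α then T β α else 0) := by
    intro α hα β hβ
    have ha := hx α hα
    have hb := hx β hβ
    have hd : ∀ c d : ℝ, c • α = d • β → c * α x = d * β x := fun c d h => by
      simpa using DFunLike.congr_fun h x
    have h1 : α = β → 1 * α x = 1 * β x := fun h => hd 1 1 (by rw [h])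
    have h2 : (2 : ℝ) • α = β → 2 * α x = 1 * β x := fun h => hd 2 1 (by rw [h, one_smul])
    have h3 : (2 : ℝ) • β = α → 1 * α x = 2 * β x := fun h => hd 1 2 (by rw [h, one_smul])
    by_cases h : α v * β x - α x * β v = 0
    · rw [if_pos h]
      have hc := hv α hα β hβ h
      have hc0 := div_pos hb ha
      have hx' : β x = β x / α x * α x := by field_simp
      rcases D.eq_of_smul_mem_roots (hP.mem_roots hα) hc0 (hc ▸ hP.mem_roots hβ) with e | e | e <;>
        rw [e] at hc hx'
      · have h4 : (2 : ℝ) • β = α := by rw [hc, smul_smul]; norm_num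
        rw [if_neg fun h => by linarith [h1 h], if_neg fun h => by linarith [h2 h], if_pos h4,
          zero_add, zero_add, hT]
      · rw [one_smul] at hc
        rw [if_pos hc.symm, if_neg fun h => by linarith [h2 h], if_neg fun h => by linarith [h3 h],
          add_zero, add_zero]
      · rw [if_neg fun h => by linarith [h1 h], if_pos hc.symm, if_neg fun h => by linarith [h3 h],
          add_zero, zero_add]
    · rw [if_neg h, if_neg, if_neg, if_neg, add_zero, add_zero]
      · rintro rfl
        apply h
        simp only [smul_apply, smul_eq_mul]
        ring
      · rintro rfl
        apply h
        simp only [smul_apply, smul_eq_mul]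
        ring
      · rintro rfl
        apply h
        ring
  rw [Finset.sum_congr rfl fun α hα => Finset.sum_congr rfl (hsplit α hα)]
  simp only [Finset.sum_add_distrib]
  have h2 : ∀ α ∈ P, ∑ β ∈ P, (if (2 : ℝ) • α = β then T α β else 0) =
      D.mult α * D.mult ((2 : ℝ) • α) * ‖α‖ ^ 2 / α x ^ 2 := by
    intro α hα
    rw [Finset.sum_ite_eq P]
    split_ifs with h
    · have := (hx α hα).ne'
      simp only [T, rootVec_smul, map_smul, smul_apply, smul_eq_mul, apply_rootVec_self]
      field_simp
    · have hr : (2 : ℝ) • α ∉ D.roots := by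
        obtain ⟨h0, -, hh⟩ := hP
        intro hr
        refine h ((hh _).2 ⟨hr, ?_⟩)
        simpa using ((hh α).1 hα).2
      rw [D.mult_eq_zero (smul_ne_zero two_ne_zero (hP.mem_roots hα).1) hr]
      simp
  rw [Finset.sum_comm (f := fun α β => if (2 : ℝ) • β = α then T β α else 0),
    Finset.sum_congr rfl h2, ← Finset.sum_add_distrib, ← Finset.sum_add_distrib]
  refine Finset.sum_congr rfl fun α hα => ?_
  rw [Finset.sum_ite_eq P, if_pos hα]
  simp only [T, apply_rootVec_self]
  have := (hx α hα).ne'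
  field_simp
  ring

end

end CartanData

/-! ### Orthonormal frames adapted to the root space decomposition -/

namespace CartanData

noncomputable section

variable {𝔤 : Type*} [LieRing 𝔤] [LieAlgebra ℝ 𝔤] (D : CartanData 𝔤)

/-- The normalized component `(X + θX) / √2` of `X` in `𝔨`. -/
def kVec (X : 𝔤) : D.𝔨 := ⟨(√2)⁻¹ • (X + D.θ X), by
  change D.θ ((√2)⁻¹ • (X + D.θ X)) = (√2)⁻¹ • (X + D.θ X)
  rw [map_smul, map_add, D.involutive, add_comm]⟩

/-- The normalized component `(X - θX) / √2` of `X` in `𝔭`. -/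
def pVec (X : 𝔤) : D.𝔭 := ⟨(√2)⁻¹ • (X - D.θ X), by
  change D.θ ((√2)⁻¹ • (X - D.θ X)) = -((√2)⁻¹ • (X - D.θ X))
  rw [map_smul, map_sub, D.involutive, ← smul_neg, neg_sub]⟩

theorem coe_kVec (X : 𝔤) : (D.kVec X : 𝔤) = (√2)⁻¹ • (X + D.θ X) := rfl

theorem coe_pVec (X : 𝔤) : (D.pVec X : 𝔤) = (√2)⁻¹ • (X - D.θ X) := rfl

theorem lie_kVec {α : StrongDual ℝ D.𝔞} {X : 𝔤} (hX : X ∈ D.rootSpace α) (h : D.𝔞) :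
    ⁅(h : 𝔤), (D.kVec X : 𝔤)⁆ = α h • (D.pVec X : 𝔤) := by
  rw [coe_kVec, coe_pVec, lie_smul, lie_add, hX h, D.θ_mem_rootSpace hX h, neg_apply, neg_smul,
    ← sub_eq_add_neg, ← smul_sub, smul_comm]

theorem lie_pVec {α : StrongDual ℝ D.𝔞} {X : 𝔤} (hX : X ∈ D.rootSpace α) (h : D.𝔞) :
    ⁅(h : 𝔤), (D.pVec X : 𝔤)⁆ = α h • (D.kVec X : 𝔤) := by
  rw [coe_kVec, coe_pVec, lie_smul, lie_sub, hX h, D.θ_mem_rootSpace hX h, neg_apply, neg_smul,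
    sub_neg_eq_add, ← smul_add, smul_comm]

theorem inner_kVec (X Y : 𝔤) : ⟪D.kVec X, D.kVec Y⟫_ℝ =
    -killingForm ℝ 𝔤 X (D.θ Y) - killingForm ℝ 𝔤 X (D.θ (D.θ Y)) := by
  have h2 : (√2)⁻¹ * (√2)⁻¹ = (1 / 2 : ℝ) := by
    rw [← mul_inv, Real.mul_self_sqrt zero_le_two]; norm_num
  rw [inner_𝔨, θ_coe_𝔨, coe_kVec, coe_kVec, D.involutive]
  simp only [map_smul, map_add, LinearMap.smul_apply, LinearMap.add_apply, smul_eq_mul,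
    D.killingForm_θ, D.killingForm_θ_left X Y]
  linear_combination (-2 * killingForm ℝ 𝔤 X Y - 2 * killingForm ℝ 𝔤 X (D.θ Y)) * h2

theorem inner_pVec (X Y : 𝔤) : ⟪D.pVec X, D.pVec Y⟫_ℝ =
    -killingForm ℝ 𝔤 X (D.θ Y) + killingForm ℝ 𝔤 X (D.θ (D.θ Y)) := by
  have h2 : (√2)⁻¹ * (√2)⁻¹ = (1 / 2 : ℝ) := by
    rw [← mul_inv, Real.mul_self_sqrt zero_le_two]; norm_num
  rw [inner_𝔭, θ_coe_𝔭, coe_pVec, coe_pVec, D.involutive]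
  simp only [map_smul, map_sub, map_neg, LinearMap.smul_apply, LinearMap.sub_apply, smul_eq_mul,
    D.killingForm_θ, D.killingForm_θ_left X Y]
  linear_combination (2 * killingForm ℝ 𝔤 X Y - 2 * killingForm ℝ 𝔤 X (D.θ Y)) * h2

/-- The inclusion `𝔞 → 𝔭` as a linear isometry. -/
def toPₗᵢ : D.𝔞 →ₗᵢ[ℝ] D.𝔭 where
  toFun := D.toP
  map_add' _ _ := rfl
  map_smul' _ _ := rfl
  norm_map' x := by
    rw [← sq_eq_sq₀ (norm_nonneg _) (norm_nonneg _), ← real_inner_self_eq_norm_sq,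
      ← real_inner_self_eq_norm_sq]
    rfl

theorem mem_rootSpace_zero (a : D.𝔞) : (a : 𝔤) ∈ D.rootSpace 0 := fun h => by
  simp [D.abelian h h.2 a a.2]

theorem inner_toP_pVec {α : StrongDual ℝ D.𝔞} (hα : α ≠ 0) {X : 𝔤} (hX : X ∈ D.rootSpace α)
    (a : D.𝔞) : ⟪D.toP a, D.pVec X⟫_ℝ = 0 := by
  have h1 := D.killingForm_θ_eq_zero hα.symm (D.mem_rootSpace_zero a) hX
  have h2 := D.killingForm_θ_eq_zero (neg_ne_zero.2 hα).symm (D.mem_rootSpace_zero a)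
    (D.θ_mem_rootSpace hX)
  rw [inner_𝔭, coe_pVec, map_smul, map_sub, map_smul, map_sub]
  change -((√2)⁻¹ • (killingForm ℝ 𝔤 (a : 𝔤) (D.θ X) - killingForm ℝ 𝔤 (a : 𝔤) (D.θ (D.θ X)))) = 0
  rw [h1, h2]
  simp

theorem IsPositiveSystem.ne_neg {D : CartanData 𝔤} {P : Finset (StrongDual ℝ D.𝔞)}
    (hP : D.IsPositiveSystem P) {α β : StrongDual ℝ D.𝔞} (hα : α ∈ P) (hβ : β ∈ P) : α ≠ -β := by
  obtain ⟨h, -, h2⟩ := hP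
  rintro rfl
  have h3 := ((h2 _).1 hα).2
  have h4 := ((h2 _).1 hβ).2
  rw [neg_apply] at h3
  linarith

variable [FiniteDimensional ℝ 𝔤]

theorem exists_orthonormal_rootSpace (α : StrongDual ℝ D.𝔞) :
    ∃ b : Fin (D.mult α) → 𝔤, Submodule.span ℝ (range b) = D.rootSpace α ∧
      ∀ i j, -killingForm ℝ 𝔤 (b i) (D.θ (b j)) = if i = j then 1 else 0 := by
  let : NormedAddCommGroup (D.rootSpace α) := (D.core (D.rootSpace α)).toNormedAddCommGroup
  let : InnerProductSpace ℝ (D.rootSpace α) :=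
    InnerProductSpace.ofCore (D.core (D.rootSpace α)).toCore
  let e := stdOrthonormalBasis ℝ (D.rootSpace α)
  refine ⟨fun i => (e i : 𝔤), ?_, fun i j => ?_⟩
  · have h := congrArg (Submodule.map (D.rootSpace α).subtype) e.toBasis.span_eq
    rw [Submodule.map_span, ← range_comp, Submodule.map_subtype_top] at h
    simpa [Function.comp_def] using! h
  · exact orthonormal_iff_ite.1 e.orthonormal i j

/-- An orthonormal basis of the root space of `α`. -/
def rootBasis (α : StrongDual ℝ D.𝔞) : Fin (D.mult α) → 𝔤 :=
  (D.exists_orthonormal_rootSpace α).choose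

theorem span_rootBasis (α : StrongDual ℝ D.𝔞) :
    Submodule.span ℝ (range (D.rootBasis α)) = D.rootSpace α :=
  (D.exists_orthonormal_rootSpace α).choose_spec.1

theorem killingForm_rootBasis (α : StrongDual ℝ D.𝔞) (i j : Fin (D.mult α)) :
    -killingForm ℝ 𝔤 (D.rootBasis α i) (D.θ (D.rootBasis α j)) = if i = j then 1 else 0 :=
  (D.exists_orthonormal_rootSpace α).choose_spec.2 i j

theorem rootBasis_mem (α : StrongDual ℝ D.𝔞) (i : Fin (D.mult α)) :
    D.rootBasis α i ∈ D.rootSpace α := by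
  rw [← D.span_rootBasis α]
  exact Submodule.subset_span (mem_range_self i)

variable (P : Finset (StrongDual ℝ D.𝔞))

/-- The positive roots, each counted with its multiplicity. -/
abbrev PosIndex : Type _ := Σ α : P, Fin (D.mult α.1)

/-- The frame `Z` of the orthogonal complement of the centralizer of `𝔞` in `𝔨`. -/
def kFrame (i : D.PosIndex P) : D.𝔨 := D.kVec (D.rootBasis i.1 i.2)

/-- The frame `Y` of the orthogonal complement of `𝔞` in `𝔭`. -/
def pFrame (i : D.PosIndex P) : D.𝔭 := D.pVec (D.rootBasis i.1 i.2)

variable {P}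

theorem lie_kFrame (i : D.PosIndex P) (h : D.𝔞) :
    ⁅(h : 𝔤), (D.kFrame P i : 𝔤)⁆ = i.1.1 h • (D.pFrame P i : 𝔤) :=
  D.lie_kVec (D.rootBasis_mem _ _) h

theorem lie_pFrame (i : D.PosIndex P) (h : D.𝔞) :
    ⁅(h : 𝔤), (D.pFrame P i : 𝔤)⁆ = i.1.1 h • (D.kFrame P i : 𝔤) :=
  D.lie_pVec (D.rootBasis_mem _ _) h

theorem ζ_kFrame_toP (i : D.PosIndex P) (h : D.𝔞) :
    D.ζ (D.kFrame P i) (D.toP h) = -(i.1.1 h • D.pFrame P i) := by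
  refine Subtype.ext ?_
  change ⁅(D.kFrame P i : 𝔤), (h : 𝔤)⁆ = -(i.1.1 h • (D.pFrame P i : 𝔤))
  rw [← lie_skew, lie_kFrame]

theorem killingForm_rootBasis_θ_θ (hP : D.IsPositiveSystem P) (i j : D.PosIndex P) :
    killingForm ℝ 𝔤 (D.rootBasis i.1 i.2) (D.θ (D.θ (D.rootBasis j.1 j.2))) = 0 :=
  D.killingForm_θ_eq_zero (hP.ne_neg i.1.2 j.1.2) (D.rootBasis_mem _ _)
    (D.θ_mem_rootSpace (D.rootBasis_mem _ _))

theorem killingForm_rootBasis_θ [DecidableEq (D.PosIndex P)] (i j : D.PosIndex P) :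
    -killingForm ℝ 𝔤 (D.rootBasis i.1 i.2) (D.θ (D.rootBasis j.1 j.2)) =
      if i = j then 1 else 0 := by
  obtain ⟨α, i⟩ := i
  obtain ⟨β, j⟩ := j
  by_cases h : α = β
  · subst h
    rw [D.killingForm_rootBasis]
    simp
  · rw [D.killingForm_θ_eq_zero (fun e => h (Subtype.ext e)) (D.rootBasis_mem _ _)
      (D.rootBasis_mem _ _), neg_zero, if_neg]
    exact fun e => h (congrArg Sigma.fst e)

theorem orthonormal_kFrame (hP : D.IsPositiveSystem P) : Orthonormal ℝ (D.kFrame P) := by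
  classical
  refine orthonormal_iff_ite.2 fun i j => ?_
  rw [kFrame, kFrame, inner_kVec, D.killingForm_rootBasis_θ_θ hP, sub_zero, killingForm_rootBasis_θ]

theorem orthonormal_pFrame (hP : D.IsPositiveSystem P) : Orthonormal ℝ (D.pFrame P) := by
  classical
  refine orthonormal_iff_ite.2 fun i j => ?_
  rw [pFrame, pFrame, inner_pVec, D.killingForm_rootBasis_θ_θ hP, add_zero, killingForm_rootBasis_θ]

/-- For `ε = ±1`, the projections `W + ε θW` of the root spaces span the corresponding eigenspace of
`θ`; negative roots contribute nothing new because `θ` exchanges them with positive ones. -/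
theorem add_smul_θ_mem (hP : D.IsPositiveSystem P) {ε : ℝ} (hε : ε * ε = 1) (W : 𝔤) :
    W + ε • D.θ W ∈ D.rootSpace 0 ⊔ Submodule.span ℝ (range fun i : D.PosIndex P =>
      D.rootBasis i.1 i.2 + ε • D.θ (D.rootBasis i.1 i.2)) := by
  set S := D.rootSpace 0 ⊔ Submodule.span ℝ (range fun i : D.PosIndex P =>
      D.rootBasis i.1 i.2 + ε • D.θ (D.rootBasis i.1 i.2)) with hS
  let f : 𝔤 →ₗ[ℝ] 𝔤 := LinearMap.id + ε • (D.θ.toLinearEquiv : 𝔤 →ₗ[ℝ] 𝔤)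
  have hf : ∀ W, f W = W + ε • D.θ W := fun W => rfl
  have hpos : ∀ α ∈ P, D.rootSpace α ≤ S.comap f := by
    intro α hα
    rw [← D.span_rootBasis α, Submodule.span_le]
    rintro _ ⟨i, rfl⟩
    exact (le_sup_right : _ ≤ S)
      (Submodule.subset_span (mem_range_self (⟨⟨α, hα⟩, i⟩ : D.PosIndex P)))
  have hle : ⨆ α, D.rootSpace α ≤ S.comap f := by
    refine iSup_le fun α => ?_
    by_cases h0 : α = 0
    · subst h0
      intro X hX
      refine (le_sup_left : _ ≤ S) (Submodule.add_mem _ hX (Submodule.smul_mem _ _ ?_))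
      simpa using D.θ_mem_rootSpace hX
    by_cases hb : D.rootSpace α = ⊥
    · rw [hb]
      exact bot_le
    obtain ⟨h, h1, h2⟩ := id hP
    have hα : α ∈ D.roots := ⟨h0, hb⟩
    rcases lt_or_gt_of_ne (h1 α hα) with hlt | hlt
    · have hn : -α ∈ P := (h2 _).2 ⟨D.neg_mem_roots hα, by simpa using hlt⟩
      intro X hX
      have h3 := S.smul_mem ε (hpos _ hn (D.θ_mem_rootSpace hX))
      rw [hf, D.involutive, smul_add, smul_smul, hε, one_smul, add_comm] at h3
      exact h3
    · exact hpos α ((h2 α).2 ⟨hα, hlt⟩)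
  rw [D.iSup_rootSpace] at hle
  exact hle trivial

/-- `𝔨` is the sum of the centralizer of `𝔞` and of the span of the frame `Z`. -/
theorem exists_eq_add_kFrame (hP : D.IsPositiveSystem P) (X : D.𝔨) :
    ∃ M : D.𝔨, (∀ h : D.𝔞, ⁅(h : 𝔤), (M : 𝔤)⁆ = 0) ∧
      ∃ S ∈ Submodule.span ℝ (range (D.kFrame P)), X = M + S := by
  obtain ⟨M, hM, S, hS, hMS⟩ :=
    Submodule.mem_sup.1 (D.add_smul_θ_mem hP (one_mul 1) (X : 𝔤))
  have hS' : S ∈ (Submodule.span ℝ (range (D.kFrame P))).map D.𝔨.subtype := by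
    refine Submodule.span_le.2 ?_ hS
    rintro _ ⟨i, rfl⟩
    refine ⟨√2 • D.kFrame P i, Submodule.smul_mem _ _ (Submodule.subset_span ⟨i, rfl⟩), ?_⟩
    change √2 • (√2)⁻¹ • (D.rootBasis i.1 i.2 + D.θ (D.rootBasis i.1 i.2)) = _
    rw [smul_inv_smul₀ (by positivity)]
    simp
  obtain ⟨S', hS', rfl⟩ := hS'
  rw [one_smul, θ_coe_𝔨, ← two_smul ℝ] at hMS
  have hX : (X : 𝔤) = (1 / 2 : ℝ) • M + (1 / 2 : ℝ) • (S' : 𝔤) := by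
    rw [← smul_add]
    change _ = _ • (M + D.𝔨.subtype S')
    rw [hMS, smul_smul]
    norm_num
  refine ⟨X - (1 / 2 : ℝ) • S', fun h => ?_, (1 / 2 : ℝ) • S', Submodule.smul_mem _ _ hS', by abel⟩
  have : ((X - (1 / 2 : ℝ) • S' : D.𝔨) : 𝔤) = (1 / 2 : ℝ) • M := by
    rw [Submodule.coe_sub, hX, Submodule.coe_smul, add_sub_cancel_right]
  rw [this, lie_smul, hM h]
  simp

/-- `𝔭` is the sum of `𝔞` and of the span of the frame `Y`. -/
theorem exists_eq_add_pFrame (hP : D.IsPositiveSystem P) (p : D.𝔭) :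
    ∃ a : D.𝔞, ∃ S ∈ Submodule.span ℝ (range (D.pFrame P)), p = D.toP a + S := by
  obtain ⟨M, hM, S, hS, hMS⟩ :=
    Submodule.mem_sup.1 (D.add_smul_θ_mem hP (ε := -1) (by norm_num) (p : 𝔤))
  have hS' : S ∈ (Submodule.span ℝ (range (D.pFrame P))).map D.𝔭.subtype := by
    refine Submodule.span_le.2 ?_ hS
    rintro _ ⟨i, rfl⟩
    refine ⟨√2 • D.pFrame P i, Submodule.smul_mem _ _ (Submodule.subset_span ⟨i, rfl⟩), ?_⟩
    change √2 • (√2)⁻¹ • (D.rootBasis i.1 i.2 - D.θ (D.rootBasis i.1 i.2)) = _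
    rw [smul_inv_smul₀ (by positivity)]
    simp [sub_eq_add_neg]
  obtain ⟨S', hS', rfl⟩ := hS'
  rw [neg_one_smul, θ_coe_𝔭, neg_neg, ← two_smul ℝ] at hMS
  have hX : (p : 𝔤) = (1 / 2 : ℝ) • M + (1 / 2 : ℝ) • (S' : 𝔤) := by
    rw [← smul_add]
    change _ = _ • (M + D.𝔭.subtype S')
    rw [hMS, smul_smul]
    norm_num
  have hM' : ((p - (1 / 2 : ℝ) • S' : D.𝔭) : 𝔤) = (1 / 2 : ℝ) • M := by
    rw [Submodule.coe_sub, hX, Submodule.coe_smul, add_sub_cancel_right]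
  have ha : ((p - (1 / 2 : ℝ) • S' : D.𝔭) : 𝔤) ∈ D.𝔞 := by
    refine D.mem_𝔞_of_lie_eq_zero (D.θ_coe_𝔭 _) fun h => ?_
    rw [hM', lie_smul, hM h]
    simp
  refine ⟨⟨_, ha⟩, (1 / 2 : ℝ) • S', Submodule.smul_mem _ _ hS', ?_⟩
  refine Subtype.ext ?_
  change (p : 𝔤) = ((p - (1 / 2 : ℝ) • S' : D.𝔭) : 𝔤) + ((1 / 2 : ℝ) • S' : D.𝔭)
  rw [← Submodule.coe_add, sub_add_cancel]

/-- An orthonormal basis of `𝔭` made of one of `𝔞` and of the frame `Y`. -/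
def pBasis (hP : D.IsPositiveSystem P) :
    OrthonormalBasis (Fin (Module.finrank ℝ D.𝔞) ⊕ D.PosIndex P) ℝ D.𝔭 :=
  OrthonormalBasis.mk
    (v := Sum.elim (fun i => D.toP (stdOrthonormalBasis ℝ D.𝔞 i)) (D.pFrame P))
    (by
      classical
      have h1 : Orthonormal ℝ fun i => D.toP (stdOrthonormalBasis ℝ D.𝔞 i) :=
        (stdOrthonormalBasis ℝ D.𝔞).orthonormal.comp_linearIsometry D.toPₗᵢ
      have h2 : ∀ i j, ⟪D.toP (stdOrthonormalBasis ℝ D.𝔞 i), D.pFrame P j⟫_ℝ = 0 := fun i j =>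
        D.inner_toP_pVec (hP.mem_roots j.1.2).1 (D.rootBasis_mem _ _) _
      rw [orthonormal_iff_ite]
      rintro (i | i) (j | j)
      · simpa using orthonormal_iff_ite.1 h1 i j
      · simpa using h2 i j
      · simpa [real_inner_comm] using h2 j i
      · simpa using orthonormal_iff_ite.1 (D.orthonormal_pFrame hP) i j)
    (by
      rintro p -
      obtain ⟨a, S, hS, rfl⟩ := D.exists_eq_add_pFrame hP p
      refine Submodule.add_mem _ ?_ (Submodule.span_mono ?_ hS)
      · have ha : a ∈ Submodule.span ℝ (range (stdOrthonormalBasis ℝ D.𝔞)) := by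
          rw [← OrthonormalBasis.coe_toBasis, Module.Basis.span_eq]
          trivial
        have h := Submodule.mem_map_of_mem (f := D.toPₗᵢ.toLinearMap) ha
        rw [Submodule.map_span, ← range_comp] at h
        refine Submodule.span_mono ?_ h
        rintro _ ⟨i, rfl⟩
        exact ⟨Sum.inl i, rfl⟩
      · rintro _ ⟨i, rfl⟩
        exact ⟨Sum.inr i, rfl⟩)

theorem pBasis_inl (hP : D.IsPositiveSystem P) (i : Fin (Module.finrank ℝ D.𝔞)) :
    D.pBasis hP (Sum.inl i) = D.toP (stdOrthonormalBasis ℝ D.𝔞 i) := by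
  simp [pBasis]

theorem pBasis_inr (hP : D.IsPositiveSystem P) (i : D.PosIndex P) :
    D.pBasis hP (Sum.inr i) = D.pFrame P i := by
  simp [pBasis]

end

end CartanData

/-! ### The orbit volume density on the Weyl chamber -/

namespace CartanData

noncomputable section

variable {𝔤 : Type*} [LieRing 𝔤] [LieAlgebra ℝ 𝔤] (D : CartanData 𝔤)

/-- The map `X ↦ [X, q]`, linear in `X`. -/
def orbitMap (q : D.𝔭) : D.𝔨 →ₗ[ℝ] D.𝔭 where
  toFun X := D.ζ X q
  map_add' X Y := by ext; simp [ζ]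
  map_smul' c X := by ext; simp [ζ]

theorem mem_stab {q : D.𝔭} {X : D.𝔨} : X ∈ D.stab q ↔ D.ζ X q = 0 := Iff.rfl

theorem _root_.OrthonormalBasis.gram_eq_toMatrix {V W ι : Type*} [NormedAddCommGroup V]
    [InnerProductSpace ℝ V] [NormedAddCommGroup W] [InnerProductSpace ℝ W] [Fintype ι]
    [DecidableEq ι] [FiniteDimensional ℝ V] [FiniteDimensional ℝ W]
    (e : OrthonormalBasis ι ℝ V) (L : V →ₗ[ℝ] W) :
    (Matrix.of fun i j => ⟪L (e i), L (e j)⟫_ℝ) =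
      LinearMap.toMatrix e.toBasis e.toBasis (LinearMap.adjoint L ∘ₗ L) := by
  ext i j
  rw [LinearMap.toMatrix_apply, OrthonormalBasis.coe_toBasis,
    OrthonormalBasis.coe_toBasis_repr_apply, OrthonormalBasis.repr_apply_apply,
    LinearMap.comp_apply, LinearMap.adjoint_inner_right, Matrix.of_apply]

/-- The determinant of a Gram matrix does not depend on the orthonormal basis. -/
theorem _root_.OrthonormalBasis.det_gram_eq {V W ι κ : Type*} [NormedAddCommGroup V]
    [InnerProductSpace ℝ V] [NormedAddCommGroup W] [InnerProductSpace ℝ W] [Fintype ι] [Fintype κ]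
    [DecidableEq ι] [DecidableEq κ] [FiniteDimensional ℝ V] [FiniteDimensional ℝ W]
    (e : OrthonormalBasis ι ℝ V) (e' : OrthonormalBasis κ ℝ V) (L : V →ₗ[ℝ] W) :
    (Matrix.of fun i j => ⟪L (e i), L (e j)⟫_ℝ).det =
      (Matrix.of fun i j => ⟪L (e' i), L (e' j)⟫_ℝ).det := by
  rw [e.gram_eq_toMatrix, e'.gram_eq_toMatrix, LinearMap.det_toMatrix, LinearMap.det_toMatrix]

variable [FiniteDimensional ℝ 𝔤] {P : Finset (StrongDual ℝ D.𝔞)}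

/-- On the chamber `ad x` is invertible on the span of the frames, so an element of `𝔨` that
commutes with `x` is orthogonal to the frame `Z`. -/
theorem inner_kFrame_eq_zero {x : D.𝔞} (hx : x ∈ D.chamber P) {X : D.𝔨}
    (hX : ⁅(x : 𝔤), (X : 𝔤)⁆ = 0) (i : D.PosIndex P) : ⟪X, D.kFrame P i⟫_ℝ = 0 := by
  have hα : i.1.1 x ≠ 0 := (hx i.1.1 i.1.2).ne'
  have h1 : (D.kFrame P i : 𝔤) =
      (i.1.1 x)⁻¹ • ⁅(x : 𝔤), (D.pFrame P i : 𝔤)⁆ := by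
    rw [lie_pFrame, inv_smul_smul₀ hα]
  rw [inner_𝔨, h1, map_smul, map_smul, ← D.killingForm_lie_θ, hX]
  simp

theorem stab_orthogonal_eq_span (hP : D.IsPositiveSystem P) {x : D.𝔞} (hx : x ∈ D.chamber P) :
    (D.stab (D.toP x))ᗮ = Submodule.span ℝ (range (D.kFrame P)) := by
  have hstab : ∀ X : D.𝔨, X ∈ D.stab (D.toP x) ↔ ⁅(x : 𝔤), (X : 𝔤)⁆ = 0 := by
    intro X
    rw [← lie_skew, neg_eq_zero, mem_stab, Subtype.ext_iff]
    rfl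
  suffices h : D.stab (D.toP x) = (Submodule.span ℝ (range (D.kFrame P)))ᗮ by
    rw [h, Submodule.orthogonal_orthogonal]
  have hle : D.stab (D.toP x) ≤ (Submodule.span ℝ (range (D.kFrame P)))ᗮ := by
    intro X hX
    rw [Submodule.mem_orthogonal']
    intro S hS
    induction hS using Submodule.span_induction with
    | mem y hy =>
      obtain ⟨i, rfl⟩ := hy
      exact D.inner_kFrame_eq_zero hx ((hstab X).1 hX) i
    | zero => exact inner_zero_right _
    | add y z _ _ hy hz => rw [inner_add_right, hy, hz, add_zero]
    | smul c y _ hy => rw [inner_smul_right, hy, mul_zero]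
  refine le_antisymm hle fun X hX => ?_
  obtain ⟨M, hM, S, hS, rfl⟩ := D.exists_eq_add_kFrame hP X
  have hMs : M ∈ D.stab (D.toP x) := (hstab M).2 (hM x)
  have hS0 : S ∈ (Submodule.span ℝ (range (D.kFrame P)))ᗮ := by
    simpa using Submodule.sub_mem _ hX (hle hMs)
  have : S = 0 := by
    have := Submodule.inner_right_of_mem_orthogonal hS hS0
    exact inner_self_eq_zero.1 this
  rwa [this, add_zero]

/-- On the Weyl chamber the orbit volume density is `∏ α(x) ^ m_α`. -/
theorem δa_eq_prod (hP : D.IsPositiveSystem P) {x : D.𝔞} (hx : x ∈ D.chamber P) :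
    D.δa x = ∏ α ∈ P, α x ^ D.mult α := by
  classical
  have hspan := D.stab_orthogonal_eq_span hP hx
  have hmem : ∀ i, D.kFrame P i ∈ (D.stab (D.toP x))ᗮ := fun i => by
    rw [hspan]
    exact Submodule.subset_span (mem_range_self i)
  let v : D.PosIndex P → (D.stab (D.toP x))ᗮ := fun i => ⟨D.kFrame P i, hmem i⟩
  have hv : Orthonormal ℝ v := by
    have h := D.orthonormal_kFrame hP
    rw [orthonormal_iff_ite] at h ⊢
    exact h
  have hvspan : ⊤ ≤ Submodule.span ℝ (range v) := by
    rintro ⟨X, hX⟩ -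
    have h : X ∈ (Submodule.span ℝ (range v)).map (D.stab (D.toP x))ᗮ.subtype := by
      rw [Submodule.map_span, ← range_comp]
      rwa [hspan] at hX
    obtain ⟨Y, hY, rfl⟩ := h
    exact hY
  let e' := OrthonormalBasis.mk hv hvspan
  let L := D.orbitMap (D.toP x) ∘ₗ (D.stab (D.toP x))ᗮ.subtype
  have h1 := OrthonormalBasis.det_gram_eq (stdOrthonormalBasis ℝ (D.stab (D.toP x))ᗮ) e' L
  have hL : ∀ i, L (e' i) = -(i.1.1 x • D.pFrame P i) := fun i => by
    have : e' i = v i := by simp [e']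
    rw [this]
    exact D.ζ_kFrame_toP i x
  have h2 : (Matrix.of fun i j => ⟪L (e' i), L (e' j)⟫_ℝ) =
      Matrix.diagonal fun i : D.PosIndex P => i.1.1 x ^ 2 := by
    ext i j
    rw [Matrix.of_apply, hL, hL, inner_neg_neg, real_inner_smul_left, real_inner_smul_right,
      orthonormal_iff_ite.1 (D.orthonormal_pFrame hP), Matrix.diagonal_apply]
    split_ifs with h
    · subst h
      ring
    · ring
  rw [h2, Matrix.det_diagonal, Finset.prod_pow] at h1
  have h3 : ∏ i : D.PosIndex P, i.1.1 x = ∏ α ∈ P, α x ^ D.mult α := by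
    rw [Fintype.prod_sigma]
    simp only [Finset.prod_const, Finset.card_univ, Fintype.card_fin]
    exact Finset.prod_coe_sort P fun α => α x ^ D.mult α
  have h4 : 0 ≤ ∏ α ∈ P, α x ^ D.mult α :=
    Finset.prod_nonneg fun α hα => pow_nonneg (hx α hα).le _
  have h5 : D.δa x = √|(Matrix.of fun i j =>
      ⟪L (stdOrthonormalBasis ℝ (D.stab (D.toP x))ᗮ i),
        L (stdOrthonormalBasis ℝ (D.stab (D.toP x))ᗮ j)⟫_ℝ).det| := rfl
  rw [h5, h1, abs_of_nonneg (sq_nonneg _), h3, Real.sqrt_sq h4]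

end

end CartanData

/-! ### Conjugation of the radial operator by the square root of the density -/

section Laplacian

variable {E F : Type*} [NormedAddCommGroup E] [NormedSpace ℝ E] [NormedAddCommGroup F]
  [NormedSpace ℝ F]

theorem ContDiffAt.two_of_infty {f : E → F} {x : E} (hf : ContDiffAt ℝ ∞ f x) :
    ContDiffAt ℝ 2 f x := by
  exact_mod_cast contDiffAt_infty.1 hf 2

theorem ContDiffAt.eventually_differentiableAt {f : E → F} {x : E} (hf : ContDiffAt ℝ 2 f x) :
    ∀ᶠ y in nhds x, DifferentiableAt ℝ f y := by
  filter_upwards [hf.eventually (by simp)] with y hy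
  exact hy.differentiableAt (by simp)

theorem ContDiffAt.differentiableAt_fderiv_apply {f : E → F} {x : E} (hf : ContDiffAt ℝ 2 f x)
    (v : E) : DifferentiableAt ℝ (fun y => fderiv ℝ f y v) x :=
  ((hf.fderiv_right (m := 1) (by norm_num)).differentiableAt (by simp)).clm_apply
    (differentiableAt_const v)

theorem ContDiffAt.iteratedFDeriv_two_eq {f : E → F} {x : E} (hf : ContDiffAt ℝ 2 f x)
    (v : E) : iteratedFDeriv ℝ 2 f x ![v, v] = fderiv ℝ (fun y => fderiv ℝ f y v) x v := by
  rw [iteratedFDeriv_two_apply, fderiv_clm_apply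
    ((hf.fderiv_right (m := 1) (by norm_num)).differentiableAt (by simp)) (differentiableAt_const v)]
  simp

theorem ContDiffAt.iteratedFDeriv_two_smul {w : E → ℝ} {f : E → F} {x : E}
    (hw : ContDiffAt ℝ 2 w x) (hf : ContDiffAt ℝ 2 f x) (v : E) :
    iteratedFDeriv ℝ 2 (fun y => w y • f y) x ![v, v] =
      w x • iteratedFDeriv ℝ 2 f x ![v, v] + (2 * fderiv ℝ w x v) • fderiv ℝ f x v +
        iteratedFDeriv ℝ 2 w x ![v, v] • f x := by
  have hwf : ContDiffAt ℝ 2 (fun y => w y • f y) x := hw.smul hf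
  rw [hwf.iteratedFDeriv_two_eq, hf.iteratedFDeriv_two_eq, hw.iteratedFDeriv_two_eq]
  have h : (fun y => fderiv ℝ (fun y => w y • f y) y v) =ᶠ[nhds x]
      fun y => w y • fderiv ℝ f y v + fderiv ℝ w y v • f y := by
    filter_upwards [hw.eventually_differentiableAt, hf.eventually_differentiableAt] with y h1 h2
    rw [fderiv_fun_smul h1 h2]
    simp
  have hw' := hw.differentiableAt (by simp)
  have hf' := hf.differentiableAt (by simp)
  have hwv := hw.differentiableAt_fderiv_apply v
  have hfv := hf.differentiableAt_fderiv_apply v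
  rw [h.fderiv_eq, fderiv_fun_add (hw'.fun_smul hfv) (hwv.fun_smul hf'), fderiv_fun_smul hw' hfv,
    fderiv_fun_smul hwv hf']
  simp only [add_apply, smul_apply, ContinuousLinearMap.smulRight_apply]
  module

end Laplacian

namespace CartanData

noncomputable section

variable {𝔤 : Type*} [LieRing 𝔤] [LieAlgebra ℝ 𝔤] (D : CartanData 𝔤)

theorem isOpen_chamber (P : Finset (StrongDual ℝ D.𝔞)) : IsOpen (D.chamber P) := by
  have : D.chamber P = ⋂ α ∈ P, {x | 0 < α x} := by
    ext x
    simp [chamber]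
  rw [this]
  exact isOpen_biInter_finset fun α _ => isOpen_lt continuous_const α.continuous

/-- The logarithm `∑ m_α log α` of the density on the Weyl chamber. -/
def logDensity (P : Finset (StrongDual ℝ D.𝔞)) (x : D.𝔞) : ℝ :=
  ∑ α ∈ P, D.mult α * Real.log (α x)

/-- The function `exp (½ ∑ m_α log α)`, which is the square root of the density on the Weyl
chamber. -/
def sqrtDensity (P : Finset (StrongDual ℝ D.𝔞)) (x : D.𝔞) : ℝ :=
  Real.exp (1 / 2 * D.logDensity P x)

variable {P : Finset (StrongDual ℝ D.𝔞)}

theorem hasFDerivAt_logDensity {x : D.𝔞} (hx : x ∈ D.chamber P) :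
    HasFDerivAt (D.logDensity P) (∑ α ∈ P, (D.mult α : ℝ) • (α x)⁻¹ • α) x :=
  HasFDerivAt.fun_sum fun α hα => (α.hasFDerivAt.log (hx α hα).ne').const_mul _

theorem fderiv_logDensity {x : D.𝔞} (hx : x ∈ D.chamber P) (v : D.𝔞) :
    fderiv ℝ (D.logDensity P) x v = ∑ α ∈ P, D.mult α * ((α x)⁻¹ * α v) := by
  rw [(D.hasFDerivAt_logDensity hx).fderiv]
  simp

theorem fderiv_sqrtDensity {x : D.𝔞} (hx : x ∈ D.chamber P) (v : D.𝔞) :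
    fderiv ℝ (D.sqrtDensity P) x v =
      1 / 2 * D.sqrtDensity P x * ∑ α ∈ P, D.mult α * ((α x)⁻¹ * α v) := by
  have h : HasFDerivAt (D.sqrtDensity P) _ x :=
    ((D.hasFDerivAt_logDensity hx).const_mul (1 / 2)).exp
  rw [h.fderiv]
  simp [sqrtDensity]
  ring

theorem contDiffAt_sqrtDensity {x : D.𝔞} (hx : x ∈ D.chamber P) :
    ContDiffAt ℝ ∞ (D.sqrtDensity P) x := by
  refine Real.contDiff_exp.contDiffAt.comp x (contDiffAt_const.mul ?_)
  exact ContDiffAt.sum fun α hα =>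
    contDiffAt_const.mul (α.contDiff.contDiffAt.log (hx α hα).ne')

theorem iteratedFDeriv_two_sqrtDensity {x : D.𝔞} (hx : x ∈ D.chamber P) (v : D.𝔞) :
    iteratedFDeriv ℝ 2 (D.sqrtDensity P) x ![v, v] = D.sqrtDensity P x *
      (1 / 4 * (∑ α ∈ P, D.mult α * ((α x)⁻¹ * α v)) ^ 2 -
        1 / 2 * ∑ α ∈ P, D.mult α * ((α x)⁻¹ ^ 2 * α v ^ 2)) := by
  rw [(D.contDiffAt_sqrtDensity hx).two_of_infty.iteratedFDeriv_two_eq]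
  have h : (fun y => fderiv ℝ (D.sqrtDensity P) y v) =ᶠ[nhds x]
      fun y => 1 / 2 * D.sqrtDensity P y * ∑ α ∈ P, D.mult α * ((α y)⁻¹ * α v) := by
    filter_upwards [(D.isOpen_chamber P).mem_nhds hx] with y hy
    exact D.fderiv_sqrtDensity hy v
  have h1 : HasFDerivAt (fun y => ∑ α ∈ P, D.mult α * ((α y)⁻¹ * α v))
      (∑ α ∈ P, (D.mult α : ℝ) • (α v • (-(α x ^ 2)⁻¹ • α))) x := by
    refine HasFDerivAt.fun_sum fun α hα => ?_
    exact ((((hasDerivAt_inv (hx α hα).ne').comp_hasFDerivAt x α.hasFDerivAt)).mul_const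
      (α v)).const_mul _
  have h2 : DifferentiableAt ℝ (D.sqrtDensity P) x :=
    (D.contDiffAt_sqrtDensity hx).differentiableAt (by simp)
  have h4 : HasFDerivAt (fun y => 1 / 2 * D.sqrtDensity P y *
      ∑ α ∈ P, D.mult α * ((α y)⁻¹ * α v)) _ x := (h2.hasFDerivAt.const_mul (1 / 2)).mul h1
  rw [h.fderiv_eq, h4.fderiv]
  simp only [add_apply, smul_apply, sum_apply, smul_eq_mul, D.fderiv_sqrtDensity hx]
  have h3 : ∑ α ∈ P, (D.mult α : ℝ) * (α v * (-(α x ^ 2)⁻¹ * α v)) =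
      -∑ α ∈ P, D.mult α * ((α x)⁻¹ ^ 2 * α v ^ 2) := by
    rw [← Finset.sum_neg_distrib]
    refine Finset.sum_congr rfl fun α _ => ?_
    rw [inv_pow]
    ring
  rw [h3]
  ring

variable [FiniteDimensional ℝ 𝔤]

theorem δa_eq_exp (hP : D.IsPositiveSystem P) {x : D.𝔞} (hx : x ∈ D.chamber P) :
    D.δa x = Real.exp (D.logDensity P x) := by
  rw [D.δa_eq_prod hP hx, logDensity, Real.exp_sum]
  refine Finset.prod_congr rfl fun α hα => ?_
  rw [Real.exp_nat_mul, Real.exp_log (hx α hα)]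

theorem sqrt_δa (hP : D.IsPositiveSystem P) {x : D.𝔞} (hx : x ∈ D.chamber P) :
    √(D.δa x) = D.sqrtDensity P x := by
  have h : Real.exp (D.logDensity P x) = D.sqrtDensity P x * D.sqrtDensity P x := by
    rw [sqrtDensity, ← Real.exp_add]
    congr 1
    ring
  rw [D.δa_eq_exp hP hx, h,
    Real.sqrt_mul_self (show 0 ≤ D.sqrtDensity P x from (Real.exp_pos _).le)]

theorem gradient_log_δa (hP : D.IsPositiveSystem P) {x : D.𝔞} (hx : x ∈ D.chamber P) :
    gradient (fun y => Real.log (D.δa y)) x =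
      ∑ α ∈ P, ((D.mult α : ℝ) * (α x)⁻¹) • D.rootVec α := by
  have h : (fun y => Real.log (D.δa y)) =ᶠ[nhds x] D.logDensity P := by
    filter_upwards [(D.isOpen_chamber P).mem_nhds hx] with y hy
    rw [D.δa_eq_exp hP hy, Real.log_exp]
  refine ext_inner_right ℝ fun v => ?_
  rw [gradient, InnerProductSpace.toDual_symm_apply, h.fderiv_eq, D.fderiv_logDensity hx,
    sum_inner]
  refine Finset.sum_congr rfl fun α _ => ?_
  rw [real_inner_smul_left, inner_rootVec, mul_assoc]

theorem Δ0_eq (hP : D.IsPositiveSystem P) (f : D.𝔞 → ℂ) {x : D.𝔞} (hx : x ∈ D.chamber P) :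
    D.Δ0 f x = Laplacian.laplacian f x +
      ∑ α ∈ P, ((D.mult α : ℝ) * (α x)⁻¹) • fderiv ℝ f x (D.rootVec α) := by
  rw [Δ0, D.gradient_log_δa hP hx, map_sum]
  simp only [map_smul]

/-- Parseval's identity for the vectors dual to `α` and `β`. -/
theorem sum_apply_mul_apply {ι : Type*} [Fintype ι] (e : OrthonormalBasis ι ℝ D.𝔞)
    (α β : StrongDual ℝ D.𝔞) : ∑ i, α (e i) * β (e i) = α (D.rootVec β) := by
  rw [← D.inner_rootVec, ← e.sum_inner_mul_inner]
  refine Finset.sum_congr rfl fun i _ => ?_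
  rw [D.inner_rootVec, real_inner_comm, D.inner_rootVec]

/-- `Δ √δ = 2 V √δ`. -/
theorem laplacian_sqrtDensity (hP : D.IsPositiveSystem P) {x : D.𝔞} (hx : x ∈ D.chamber P) :
    Laplacian.laplacian (D.sqrtDensity P) x = 2 * D.potential P x * D.sqrtDensity P x := by
  let e := stdOrthonormalBasis ℝ D.𝔞
  rw [InnerProductSpace.laplacian_eq_iteratedFDeriv_orthonormalBasis _ e]
  simp only [D.iteratedFDeriv_two_sqrtDensity hx]
  rw [← Finset.mul_sum, Finset.sum_sub_distrib, ← Finset.mul_sum, ← Finset.mul_sum]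
  have h1 : ∑ i, (∑ α ∈ P, D.mult α * ((α x)⁻¹ * α (e i))) ^ 2 =
      ∑ α ∈ P, D.mult α * (D.mult α + 2 * D.mult ((2 : ℝ) • α)) * ‖α‖ ^ 2 / α x ^ 2 := by
    rw [← D.sum_sum_mult_mul_mult hP hx]
    simp only [sq, Finset.sum_mul_sum]
    rw [Finset.sum_comm]
    refine Finset.sum_congr rfl fun α _ => ?_
    rw [Finset.sum_comm]
    refine Finset.sum_congr rfl fun β _ => ?_
    rw [← D.sum_apply_mul_apply e, div_eq_mul_inv, mul_inv, Finset.mul_sum, Finset.sum_mul]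
    exact Finset.sum_congr rfl fun i _ => by ring
  have h2 : ∑ i, ∑ α ∈ P, (D.mult α : ℝ) * ((α x)⁻¹ ^ 2 * α (e i) ^ 2) =
      ∑ α ∈ P, D.mult α * ‖α‖ ^ 2 / α x ^ 2 := by
    rw [Finset.sum_comm]
    refine Finset.sum_congr rfl fun α _ => ?_
    rw [← D.apply_rootVec_self, ← D.sum_apply_mul_apply e, Finset.mul_sum, div_eq_mul_inv,
      Finset.sum_mul]
    exact Finset.sum_congr rfl fun i _ => by ring
  rw [h1, h2, potential, mul_comm]
  congr 1
  rw [Finset.mul_sum, Finset.mul_sum, Finset.mul_sum, ← Finset.sum_sub_distrib]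
  refine Finset.sum_congr rfl fun α hα => ?_
  have := (hx α hα).ne'
  field_simp
  ring

/-- Conjugation by `√δ` turns `Δ⁰` into `Δ - 2V`. -/
theorem laplacian_sqrtDensity_smul (hP : D.IsPositiveSystem P) {f : D.𝔞 → ℂ} {x : D.𝔞}
    (hx : x ∈ D.chamber P) (hf : ContDiffAt ℝ 2 f x) :
    Laplacian.laplacian (fun y => D.sqrtDensity P y • f y) x =
      D.sqrtDensity P x • (D.Δ0 f x + (2 * D.potential P x) • f x) := by
  let e := stdOrthonormalBasis ℝ D.𝔞
  have hw : ContDiffAt ℝ 2 (D.sqrtDensity P) x :=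
    (D.contDiffAt_sqrtDensity hx).two_of_infty
  have h1 : Laplacian.laplacian (fun y => D.sqrtDensity P y • f y) x =
      D.sqrtDensity P x • Laplacian.laplacian f x +
        ∑ i, (2 * fderiv ℝ (D.sqrtDensity P) x (e i)) • fderiv ℝ f x (e i) +
        Laplacian.laplacian (D.sqrtDensity P) x • f x := by
    simp only [InnerProductSpace.laplacian_eq_iteratedFDeriv_orthonormalBasis _ e,
      hw.iteratedFDeriv_two_smul hf, Finset.sum_add_distrib, Finset.smul_sum, Finset.sum_smul]
  have h2 : ∑ i, (2 * fderiv ℝ (D.sqrtDensity P) x (e i)) • fderiv ℝ f x (e i) =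
      D.sqrtDensity P x •
        ∑ α ∈ P, ((D.mult α : ℝ) * (α x)⁻¹) • fderiv ℝ f x (D.rootVec α) := by
    have h3 : ∀ α : StrongDual ℝ D.𝔞,
        fderiv ℝ f x (D.rootVec α) = ∑ i, α (e i) • fderiv ℝ f x (e i) := fun α => by
      rw [← e.sum_repr' (D.rootVec α), map_sum]
      refine Finset.sum_congr rfl fun i _ => ?_
      rw [map_smul, real_inner_comm, D.inner_rootVec]
    simp only [h3, D.fderiv_sqrtDensity hx, Finset.smul_sum]
    rw [Finset.sum_comm]
    refine Finset.sum_congr rfl fun i _ => ?_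
    rw [Finset.mul_sum, Finset.mul_sum, Finset.sum_smul]
    refine Finset.sum_congr rfl fun α _ => ?_
    rw [smul_smul, smul_smul]
    congr 1
    ring
  rw [h1, h2, D.laplacian_sqrtDensity hP hx, D.Δ0_eq hP f hx]
  module

theorem solvesCalogeroMoser (hP : D.IsPositiveSystem P) {f : D.𝔞 → ℂ} {γ : ℂ}
    (hf : D.IsEigenfunction P f γ) :
    D.SolvesCalogeroMoser P (fun t x =>
      Complex.exp (Complex.I * γ * t / 2) * (Real.sqrt (D.δa x) : ℂ) * f x) := by
  obtain ⟨hsm, -, heig⟩ := hf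
  refine ⟨?_, fun t x hx => ?_⟩
  · have h1 : ContDiffOn ℝ ∞ (fun z : ℝ × D.𝔞 => Complex.exp (Complex.I * γ * z.1 / 2) *
        (D.sqrtDensity P z.2 : ℂ) * f z.2) (univ ×ˢ D.chamber P) := by
      refine ContDiffOn.mul (ContDiffOn.mul ?_ ?_) ?_
      · refine ContDiff.contDiffOn ?_
        refine Complex.contDiff_exp.comp ?_
        exact (contDiff_const.mul (Complex.ofRealCLM.contDiff.comp contDiff_fst)).div_const 2
      · intro z hz
        refine (Complex.ofRealCLM.contDiff.contDiffAt.comp z ?_).contDiffWithinAt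
        exact (D.contDiffAt_sqrtDensity hz.2).comp z contDiffAt_snd
      · exact hsm.comp contDiffOn_snd fun z hz => hz.2
    refine h1.congr fun z hz => ?_
    simp only [D.sqrt_δa hP hz.2]
  · have hfx : ContDiffAt ℝ 2 f x :=
      ((hsm x hx).contDiffAt ((D.isOpen_chamber P).mem_nhds hx)).two_of_infty
    have hw : ContDiffAt ℝ 2 (D.sqrtDensity P) x :=
      (D.contDiffAt_sqrtDensity hx).two_of_infty
    set c := Complex.exp (Complex.I * γ * t / 2) with hc
    have hψ : (fun y => c * (√(D.δa y) : ℂ) * f y) =ᶠ[nhds x]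
        c • fun y => D.sqrtDensity P y • f y := by
      filter_upwards [(D.isOpen_chamber P).mem_nhds hx] with y hy
      rw [D.sqrt_δa hP hy, mul_assoc]
      simp
    have hlap : Laplacian.laplacian (fun y => c * (√(D.δa y) : ℂ) * f y) x =
        c • D.sqrtDensity P x • (γ * f x + (2 * D.potential P x) • f x) := by
      have hwf : ContDiffAt ℝ 2 (fun y => D.sqrtDensity P y • f y) x := hw.smul hfx
      rw [(InnerProductSpace.laplacian_congr_nhds hψ).eq_of_nhds,
        InnerProductSpace.laplacian_smul c hwf, D.laplacian_sqrtDensity_smul hP hx hfx,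
        heig x hx]
    have hder : deriv (fun s : ℝ => Complex.exp (Complex.I * γ * s / 2) *
        (√(D.δa x) : ℂ) * f x) t = c * (Complex.I * γ / 2) * (√(D.δa x) : ℂ) * f x := by
      have h : HasDerivAt (fun s : ℝ => Complex.exp (Complex.I * γ * s / 2))
          (c * (Complex.I * γ / 2)) t := by
        have h0 : HasDerivAt (fun s : ℝ => Complex.I * γ * (s : ℂ) / 2) (Complex.I * γ * 1 / 2) t :=
          ((Complex.ofRealCLM.hasDerivAt (x := t)).const_mul (Complex.I * γ)).div_const 2
        rw [mul_one] at h0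
        exact h0.cexp
      exact ((h.mul_const _).mul_const _).deriv
    rw [hder, hlap]
    simp only [D.sqrt_δa hP hx, Complex.real_smul, smul_eq_mul]
    push_cast
    linear_combination (c * γ / 2 * D.sqrtDensity P x * f x) * Complex.I_sq

end

end CartanData

/-! ### Invariant functions and the radial part of the Laplacian -/

namespace CartanData

noncomputable section

variable {𝔤 : Type*} [LieRing 𝔤] [LieAlgebra ℝ 𝔤] (D : CartanData 𝔤)

theorem inner_ζ (X : D.𝔨) (q r : D.𝔭) : ⟪D.ζ X q, r⟫_ℝ = -⟪q, D.ζ X r⟫_ℝ := by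
  rw [inner_𝔭, inner_𝔭, θ_coe_𝔭, θ_coe_𝔭, map_neg, map_neg, neg_neg, neg_neg]
  change killingForm ℝ 𝔤 ⁅(X : 𝔤), (q : 𝔤)⁆ r = -killingForm ℝ 𝔤 q ⁅(X : 𝔤), (r : 𝔤)⁆
  rw [← lie_skew, map_neg, LinearMap.neg_apply, killingForm_lie_left]

variable {P : Finset (StrongDual ℝ D.𝔞)}

/-- The origin lies in the closure of the Weyl chamber. -/
theorem exists_mem_chamber_ne_zero (hP : D.IsPositiveSystem P) {f : D.𝔞 → ℂ} (hf : ContinuousAt f 0)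
    (h0 : f 0 ≠ 0) : ∃ x ∈ D.chamber P, f x ≠ 0 := by
  obtain ⟨h, -, h2⟩ := hP
  have h3 : Filter.Tendsto (fun t : ℝ => f (t • h)) (nhdsWithin 0 (Ioi 0)) (nhds (f 0)) := by
    have h4 : ContinuousAt (fun t : ℝ => t • h) 0 := by fun_prop
    have h5 : ContinuousAt f ((0 : ℝ) • h) := by rwa [zero_smul]
    have h6 := (ContinuousAt.comp (f := fun t : ℝ => t • h) h5 h4).tendsto
    simp only [Function.comp_def, zero_smul] at h6
    exact h6.mono_left nhdsWithin_le_nhds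
  obtain ⟨t, ht, ht0⟩ := ((h3.eventually_ne h0).and self_mem_nhdsWithin).exists
  refine ⟨t • h, fun α hα => ?_, ht⟩
  rw [map_smul, smul_eq_mul]
  exact mul_pos ht0 ((h2 α).1 hα).2

variable [FiniteDimensional ℝ 𝔤]

instance : CompleteSpace D.𝔭 := FiniteDimensional.complete ℝ D.𝔭

/-- The operator `ad X` on `𝔭` as a continuous linear map. -/
def ζL (X : D.𝔨) : D.𝔭 →L[ℝ] D.𝔭 := LinearMap.toContinuousLinearMap (D.ζ X)

theorem ζL_smul (s : ℝ) (X : D.𝔨) : D.ζL (s • X) = s • D.ζL X := by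
  refine ContinuousLinearMap.ext fun q => Subtype.ext ?_
  change ⁅((s • X : D.𝔨) : 𝔤), (q : 𝔤)⁆ = s • ⁅(X : 𝔤), (q : 𝔤)⁆
  rw [Submodule.coe_smul, smul_lie]

theorem exp_zero_smul_ζL (X : D.𝔨) (q : D.𝔭) : NormedSpace.exp ((0 : ℝ) • D.ζL X) q = q := by
  have h : (0 : ℝ) • D.ζL X = 0 := zero_smul ℝ (D.ζL X)
  rw [h, NormedSpace.exp_zero]
  rfl

theorem hasDerivAt_exp_ζL (X : D.𝔨) (q : D.𝔭) (s : ℝ) :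
    HasDerivAt (fun s : ℝ => NormedSpace.exp (s • D.ζL X) q)
      (D.ζ X (NormedSpace.exp (s • D.ζL X) q)) s :=
  (ContinuousLinearMap.apply ℝ D.𝔭 q).hasFDerivAt.comp_hasDerivAt s
    (hasDerivAt_exp_smul_const' (D.ζL X) s)

theorem norm_exp_ζL (X : D.𝔨) (q : D.𝔭) : ‖NormedSpace.exp (D.ζL X) q‖ = ‖q‖ := by
  have h : ∀ s, HasDerivAt (fun s : ℝ => ‖NormedSpace.exp (s • D.ζL X) q‖ ^ 2) 0 s := by
    intro s
    have h1 := (D.hasDerivAt_exp_ζL X q s).norm_sq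
    have h2 := D.inner_ζ X (NormedSpace.exp (s • D.ζL X) q) (NormedSpace.exp (s • D.ζL X) q)
    rw [real_inner_comm] at h2
    have h3 : ⟪NormedSpace.exp (s • D.ζL X) q, D.ζ X (NormedSpace.exp (s • D.ζL X) q)⟫_ℝ = 0 := by
      linarith
    rw [h3, mul_zero] at h1
    exact h1
  have h1 := is_const_of_deriv_eq_zero (fun s => (h s).differentiableAt) (fun s => (h s).deriv) 1 0
  have h2 : (1 : ℝ) • D.ζL X = D.ζL X := one_smul ℝ (D.ζL X)
  simp only [h2, exp_zero_smul_ζL] at h1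
  exact (sq_eq_sq₀ (norm_nonneg _) (norm_nonneg _)).1 h1

theorem norm_apply_of_mem_K {k : D.𝔭 ≃L[ℝ] D.𝔭} (hk : k ∈ D.K) (q : D.𝔭) : ‖k q‖ = ‖q‖ := by
  induction hk using Subgroup.closure_induction generalizing q with
  | mem g hg =>
    obtain ⟨X, hX⟩ := hg
    have : g q = NormedSpace.exp (D.ζL X) q := DFunLike.congr_fun hX q
    rw [this, D.norm_exp_ζL]
  | one => rfl
  | mul a b _ _ ha hb => exact (ha (b q)).trans (hb q)
  | inv a _ ha =>
    rw [← ha (a⁻¹ q)]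
    exact congrArg norm (a.apply_symm_apply q)

theorem exists_mem_K_eq_exp (X : D.𝔨) :
    ∃ k ∈ D.K, ∀ q, k q = NormedSpace.exp (D.ζL X) q := by
  let : NormedAlgebra ℚ (D.𝔭 →L[ℝ] D.𝔭) := NormedAlgebra.restrictScalars ℚ ℝ _
  obtain ⟨u, hu⟩ := NormedSpace.isUnit_exp (D.ζL X)
  refine ⟨ContinuousLinearEquiv.unitsEquiv ℝ D.𝔭 u, Subgroup.subset_closure ⟨X, ?_⟩, fun q => ?_⟩
  · refine ContinuousLinearMap.ext fun q => ?_
    exact DFunLike.congr_fun hu q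
  · exact DFunLike.congr_fun hu q

/-- The derivative of a `K`-invariant function vanishes along the orbits. -/
theorem fderiv_ζ_eq_zero {F : D.𝔭 → ℂ} (hF : Differentiable ℝ F)
    (hK : ∀ k ∈ D.K, ∀ q, F (k q) = F q) (X : D.𝔨) (q : D.𝔭) :
    fderiv ℝ F q (D.ζ X q) = 0 := by
  have h1 := D.hasDerivAt_exp_ζL X q 0
  rw [exp_zero_smul_ζL] at h1
  have h2 : HasDerivAt (fun s : ℝ => F (NormedSpace.exp (s • D.ζL X) q))
      (fderiv ℝ F q (D.ζ X q)) 0 := by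
    refine HasFDerivAt.comp_hasDerivAt (0 : ℝ) ?_ h1
    rw [exp_zero_smul_ζL]
    exact (hF q).hasFDerivAt
  have h3 : (fun s : ℝ => F (NormedSpace.exp (s • D.ζL X) q)) = fun _ => F q := by
    funext s
    obtain ⟨k, hk, hkq⟩ := D.exists_mem_K_eq_exp (s • X)
    rw [← D.ζL_smul, ← hkq, hK k hk]
  rw [h3] at h2
  exact h2.unique (hasDerivAt_const _ _)

/-- The derivative of the identity `DF(q)(ζ_X q) = 0` in the direction `v`. -/
theorem fderiv_fderiv_ζ {F : D.𝔭 → ℂ} (hF : ContDiff ℝ 2 F)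
    (hK : ∀ k ∈ D.K, ∀ q, F (k q) = F q) (X : D.𝔨) (q v : D.𝔭) :
    fderiv ℝ (fderiv ℝ F) q v (D.ζ X q) + fderiv ℝ F q (D.ζ X v) = 0 := by
  have h1 : DifferentiableAt ℝ (fderiv ℝ F) q :=
    ((hF.fderiv_right (m := 1) (by norm_num)).differentiable (by simp)) q
  have h2 := (h1.hasFDerivAt.clm_apply (D.ζL X).hasFDerivAt).fderiv
  have h3 : (fun q => fderiv ℝ F q (D.ζL X q)) = fun _ => 0 :=
    funext fun q => D.fderiv_ζ_eq_zero (hF.differentiable (by simp)) hK X q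
  have h4 : fderiv ℝ (fun q => fderiv ℝ F q (D.ζL X q)) q v = 0 := by
    rw [h3]
    simp
  rw [h2] at h4
  rw [← h4, add_comm]
  rfl

theorem fderiv_pFrame_eq_zero {F : D.𝔭 → ℂ} (hF : Differentiable ℝ F)
    (hK : ∀ k ∈ D.K, ∀ q, F (k q) = F q) {x : D.𝔞} (hx : x ∈ D.chamber P) (i : D.PosIndex P) :
    fderiv ℝ F (D.toP x) (D.pFrame P i) = 0 := by
  have h := D.fderiv_ζ_eq_zero hF hK (D.kFrame P i) (D.toP x)
  rw [ζ_kFrame_toP, map_neg, map_smul, neg_eq_zero] at h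
  exact (smul_eq_zero.1 h).resolve_left (hx i.1.1 i.1.2).ne'

/-- The component of `[Z_i, Y_i]` in `𝔞` is the vector of the corresponding root. -/
theorem exists_ζ_kFrame_pFrame (hP : D.IsPositiveSystem P) (i : D.PosIndex P) :
    ∃ S ∈ Submodule.span ℝ (range (D.pFrame P)),
      D.ζ (D.kFrame P i) (D.pFrame P i) = D.toP (D.rootVec i.1.1) + S := by
  obtain ⟨a, S, hS, h⟩ := D.exists_eq_add_pFrame hP (D.ζ (D.kFrame P i) (D.pFrame P i))
  have hSa : ∀ b : D.𝔞, ⟪S, D.toP b⟫_ℝ = 0 := by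
    intro b
    clear h
    induction hS using Submodule.span_induction with
    | mem y hy =>
      obtain ⟨j, rfl⟩ := hy
      rw [real_inner_comm]
      exact D.inner_toP_pVec (hP.mem_roots j.1.2).1 (D.rootBasis_mem _ _) b
    | zero => exact inner_zero_left _
    | add y z _ _ hy hz => rw [inner_add_left, hy, hz, add_zero]
    | smul c y _ hy => rw [real_inner_smul_left, hy, mul_zero]
  have ha : a = D.rootVec i.1.1 := by
    refine ext_inner_right ℝ fun b => ?_
    have h1 := congrArg (fun p => ⟪p, D.toP b⟫_ℝ) h
    simp only [inner_add_left, hSa, add_zero, inner_ζ, ζ_kFrame_toP, inner_neg_right,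
      real_inner_smul_right, neg_neg] at h1
    rw [real_inner_self_eq_norm_sq, (D.orthonormal_pFrame hP).1 i] at h1
    rw [inner_rootVec]
    change ⟪D.toP a, D.toP b⟫_ℝ = _
    rw [← h1]
    ring
  exact ⟨S, hS, ha ▸ h⟩

/-- The second derivative of an invariant function in a direction tangent to the orbit. -/
theorem iteratedFDeriv_two_pFrame (hP : D.IsPositiveSystem P) {F : D.𝔭 → ℂ} (hF : ContDiff ℝ 2 F)
    (hK : ∀ k ∈ D.K, ∀ q, F (k q) = F q) {x : D.𝔞} (hx : x ∈ D.chamber P) (i : D.PosIndex P) :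
    iteratedFDeriv ℝ 2 F (D.toP x) ![D.pFrame P i, D.pFrame P i] =
      (i.1.1 x)⁻¹ • fderiv ℝ F (D.toP x) (D.toP (D.rootVec i.1.1)) := by
  have hα : i.1.1 x ≠ 0 := (hx i.1.1 i.1.2).ne'
  have h := D.fderiv_fderiv_ζ hF hK (D.kFrame P i) (D.toP x) (D.pFrame P i)
  obtain ⟨S, hS, hZY⟩ := D.exists_ζ_kFrame_pFrame hP i
  have hS0 : fderiv ℝ F (D.toP x) S = 0 := by
    clear h hZY
    induction hS using Submodule.span_induction with
    | mem y hy =>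
      obtain ⟨j, rfl⟩ := hy
      exact D.fderiv_pFrame_eq_zero (hF.differentiable (by simp)) hK hx j
    | zero => exact map_zero _
    | add y z _ _ hy hz => rw [map_add, hy, hz, add_zero]
    | smul c y _ hy => rw [map_smul, hy, smul_zero]
  rw [hZY, map_add, hS0, add_zero, ζ_kFrame_toP, map_neg, map_smul, neg_add_eq_zero] at h
  rw [iteratedFDeriv_two_apply, ← h, inv_smul_smul₀ hα]
  simp

/-- The radial part of the Laplacian of `𝔭` on `K`-invariant functions is `Δ⁰`. -/
theorem laplacian_toP (hP : D.IsPositiveSystem P) {F : D.𝔭 → ℂ} (hF : ContDiff ℝ 2 F)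
    (hK : ∀ k ∈ D.K, ∀ q, F (k q) = F q) {x : D.𝔞} (hx : x ∈ D.chamber P) :
    Laplacian.laplacian F (D.toP x) = D.Δ0 (fun y => F (D.toP y)) x := by
  have hcomp : (fun y => F (D.toP y)) = F ∘ D.toPₗᵢ.toContinuousLinearMap := rfl
  have h1 : fderiv ℝ (fun y => F (D.toP y)) x =
      (fderiv ℝ F (D.toP x)).comp D.toPₗᵢ.toContinuousLinearMap := by
    rw [hcomp, fderiv_comp x (hF.differentiable (by simp) _)
      D.toPₗᵢ.toContinuousLinearMap.differentiableAt, ContinuousLinearMap.fderiv]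
    rfl
  rw [D.Δ0_eq hP _ hx, InnerProductSpace.laplacian_eq_iteratedFDeriv_orthonormalBasis F
    (D.pBasis hP), InnerProductSpace.laplacian_eq_iteratedFDeriv_orthonormalBasis _
    (stdOrthonormalBasis ℝ D.𝔞)]
  simp only [Fintype.sum_sum_type, pBasis_inl, pBasis_inr, D.iteratedFDeriv_two_pFrame hP hF hK hx]
  congr 1
  · refine Finset.sum_congr rfl fun i _ => ?_
    rw [hcomp, ContinuousLinearMap.iteratedFDeriv_comp_right _ hF _ le_rfl,
      ContinuousMultilinearMap.compContinuousLinearMap_apply]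
    congr 1
    ext j
    fin_cases j <;> rfl
  · rw [Fintype.sum_sigma, h1]
    simp only [Finset.sum_const, Finset.card_univ, Fintype.card_fin]
    rw [← Finset.sum_coe_sort P]
    refine Finset.sum_congr rfl fun α _ => ?_
    rw [← Nat.cast_smul_eq_nsmul ℝ, smul_smul]
    rfl

/-- The Laplacian of `𝔭` as a formal constant coefficient operator. -/
def laplaceOp : (Σ n : ℕ, Fin n → D.𝔭) →₀ ℂ :=
  ∑ i, Finsupp.single ⟨2, ![stdOrthonormalBasis ℝ D.𝔭 i, stdOrthonormalBasis ℝ D.𝔭 i]⟩ 1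

theorem constCoeffOp_laplaceOp (F : D.𝔭 → ℂ) (q : D.𝔭) :
    constCoeffOp D.laplaceOp F q = Laplacian.laplacian F q := by
  rw [InnerProductSpace.laplacian_eq_iteratedFDeriv_stdOrthonormalBasis, constCoeffOp, laplaceOp,
    ← Finsupp.sum_finsetSum_index (by simp) (by intros; ring)]
  simp

theorem isInvariantOp_laplaceOp : D.IsInvariantOp D.laplaceOp := by
  intro k hk F hF q
  have hF2 : ContDiff ℝ 2 F := by exact_mod_cast contDiff_infty.1 hF 2
  let kᵢ : D.𝔭 ≃ₗᵢ[ℝ] D.𝔭 := ⟨k.toLinearEquiv, D.norm_apply_of_mem_K hk⟩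
  let e := stdOrthonormalBasis ℝ D.𝔭
  rw [constCoeffOp_laplaceOp, constCoeffOp_laplaceOp,
    InnerProductSpace.laplacian_eq_iteratedFDeriv_orthonormalBasis F (e.map kᵢ),
    InnerProductSpace.laplacian_eq_iteratedFDeriv_orthonormalBasis _ e]
  refine Finset.sum_congr rfl fun i _ => ?_
  have hcomp : (fun y => F (k y)) = F ∘ (k : D.𝔭 →L[ℝ] D.𝔭) := rfl
  rw [hcomp, ContinuousLinearMap.iteratedFDeriv_comp_right _ hF2 _ le_rfl,
    ContinuousMultilinearMap.compContinuousLinearMap_apply]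
  congr 1
  ext j
  fin_cases j <;> rfl

theorem IsZonalSpherical.exists_isEigenfunction {D : CartanData 𝔤}
    {P : Finset (StrongDual ℝ D.𝔞)} (hP : D.IsPositiveSystem P) {F : D.𝔭 → ℂ}
    (hF : D.IsZonalSpherical F) : ∃ γ : ℂ, D.IsEigenfunction P (fun x => F (D.toP x)) γ := by
  obtain ⟨hsm, hK, h0, hop⟩ := hF
  obtain ⟨γ, hγ⟩ := hop D.laplaceOp D.isInvariantOp_laplaceOp
  have hsm' : ContDiff ℝ ∞ fun x => F (D.toP x) :=
    hsm.comp D.toPₗᵢ.toContinuousLinearMap.contDiff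
  have hF2 : ContDiff ℝ 2 F := by exact_mod_cast contDiff_infty.1 hsm 2
  refine ⟨γ, hsm'.contDiffOn, ?_, fun x hx => ?_⟩
  · refine D.exists_mem_chamber_ne_zero hP hsm'.continuous.continuousAt ?_
    have : D.toP 0 = 0 := map_zero D.toPₗᵢ
    rw [this, h0]
    exact one_ne_zero
  · rw [← D.laplacian_toP hP hF2 hK hx, ← constCoeffOp_laplaceOp, hγ]

end

end CartanData

theorem mainTheorem3 {𝔤 : Type*} [LieRing 𝔤] [LieAlgebra ℝ 𝔤] [FiniteDimensional ℝ 𝔤]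
    [LieAlgebra.IsSemisimple ℝ 𝔤] (D : CartanData 𝔤)
    (P : Finset (StrongDual ℝ D.𝔞)) (hP : D.IsPositiveSystem P) :
    (∀ (f : D.𝔞 → ℂ) (γ : ℂ), D.IsEigenfunction P f γ →
      D.SolvesCalogeroMoser P (fun t x =>
        Complex.exp (Complex.I * γ * t / 2) * (Real.sqrt (D.δa x) : ℂ) * f x)) ∧
    (∀ F : D.𝔭 → ℂ, D.IsZonalSpherical F →
      ∃ γ : ℂ, D.IsEigenfunction P (fun x => F (D.toP x)) γ) := by
  exact ⟨fun f γ hf => D.solvesCalogeroMoser hP hf, fun F hF => hF.exists_isEigenfunction hP⟩
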